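/- Let $T>0$, $\omega=2\pi/T$, and let $A$ be a $T$-periodic $n\times n$ complex (in particular, real) matrix function with $A\in L^\infty([0,T])$ and phasors $A_k=\frac1T\int_0^T A(\tau)e^{-j\omega k\tau}\,d\tau$, $k\in\mathbb Z$. On $\ell^2(\{1,\dots,n\}\times\mathbb Z)$ consider the unbounded operator $\mathcal A-\mathcal N$ with its maximal domain, where $\mathcal A$ is the $n\times n$ block Toeplitz matrix whose $(i,i')$ block has entries $(A_{k-l})_{ii'}$, $k,l\in\mathbb Z$, and $\mathcal N=\mathrm{Id}_n\otimes\mathrm{diag}(j\omega k,\ k\in\mathbb Z)$. For an integer $m\ge 0$ let $\mathcal A_{m^+}-\mathcal N_{m^+}$ be its left $m$-truncation, obtained by deleting in each block all rows and columns with index $<-m$, considered as an operator on the corresponding $\ell^2$ space with its maximal domain. Let $\Lambda_{m^+}$ be the set of its eigenvalues, and let $V|_{m^+}$ denote the restriction of a vector $V$ to the indices $\ge -m$. The spectrum of $\mathcal A-\mathcal N$ has the form $\sigma=\{\lambda_p+j\omega k:\ k\in\mathbb Z,\ p=1,\dots,n\}$ for some $\lambda_1,\dots,\lambda_n\in\mathbb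 C$, not necessarily distinct. Moreover, for any $\lambda_1,\dots,\lambda_n$ with this property and every $\epsilon>0$ there is an index $j_0\in\mathbb N$, independent of $m$, such that, with $$\Lambda_1^+(m)=\{\lambda_p+j\omega k:\ k\in\mathbb Z,\ k\le m+1-j_0,\ p=1,\dots,n\}\subset\sigma,$$ $$\Lambda_2^+(m)=\{\mu\in\Lambda_{m^+}:\ |\mu-\lambda|\ge\epsilon\ \text{ for all }\lambda\in\Lambda_1^+(m)\},$$ the following hold for all integers $m\ge0$. 1. Every $\lambda\in\Lambda_1^+(m)$ is an eigenvalue of $\mathcal A-\mathcal N$, and for every eigenvector $V$ of $\mathcal A-\mathcal N$ for $\lambda$ with $\|V\|_{\ell^2}=1$, the vector $V|_{m^+}$ lies in the domain of $\mathcal A_{m^+}-\mathcal N_{m^+}$ and $$\|(\mathcal A_{m^+}-\mathcal N_{m^+}-\lambda\,\mathcal I_{m^+})V|_{m^+}\|_{\ell^2}<\epsilon,\qquad \|(\mathcal A_{m^+}-\mathcal N_{m^+}-\lambda\,\mathcal I_{m^+})V|_{m^+}\|_{\ell^2}<\epsilon\,\|V|_{m^+}\|_{\ell^2}.$$ 2.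 $\Lambda_{m^+}\approx\Lambda_1^+(m)\cup\Lambda_2^+(m)$ up to $\epsilon$: every element of either set is at distance less than $\epsilon$ from some element of the other. 3. The set $\Lambda_2^+(m)$ of remaining eigenvalues is a finite subset of $\Lambda_{m^+}$. 4. $\Lambda_2^+(m+1)=\{\mu+j\omega:\ \mu\in\Lambda_2^+(m)\}$. -/

import Mathlib

open MeasureTheory

namespace HarmonicState

/-- The Hilbert space of square-summable complex families indexed by `ι`. -/
abbrev EllTwo (ι : Type*) : Type _ := lp (fun _ : ι => ℂ) 2

/-- The pulsation `ω = 2π / T`. -/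
noncomputable def omega (T : ℝ) : ℝ := 2 * Real.pi / T

/-- The `k`-th phasor `(1/T) ∫₀ᵀ a(τ) exp(-jωkτ) dτ` of a `T`-periodic signal. -/
noncomputable def phasor (T : ℝ) (a : ℝ → ℂ) (k : ℤ) : ℂ :=
  (1 / (T : ℂ)) *
    ∫ τ in (0 : ℝ)..T, a τ * Complex.exp (-(Complex.I * (omega T : ℂ) * (k : ℂ) * (τ : ℂ)))

/-- `A` is essentially bounded (and a.e. strongly measurable) on a period: `A ∈ L^∞([0 T])`. -/
def EssBounded {n : ℕ} (T : ℝ) (A : ℝ → Matrix (Fin n) (Fin n) ℂ) : Prop :=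
  ∀ i j, MemLp (fun t => A t i j) ⊤ (volume.restrict (Set.Ioc 0 T))

/-- The block Toeplitz matrix `𝒯(A)`. The index `(i, k)` is row (or column) `k` of block `i`. -/
noncomputable def toeplitz {n : ℕ} (T : ℝ) (A : ℝ → Matrix (Fin n) (Fin n) ℂ) :
    Matrix (Fin n × ℤ) (Fin n × ℤ) ℂ :=
  Matrix.of fun p q => phasor T (fun t => A t p.1 q.1) (p.2 - q.2)

/-- The diagonal matrix `𝒩 = Id_n ⊗ diag(jωk, k ∈ ℤ)`. -/
noncomputable def frequency (n : ℕ) (T : ℝ) : Matrix (Fin n × ℤ) (Fin n × ℤ) ℂ :=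
  Matrix.diagonal fun p => Complex.I * (omega T : ℂ) * (p.2 : ℂ)

/-- The indices that a left `m`-truncation keeps: those whose frequency is at least `-m`. -/
abbrev LeftIndex (n m : ℕ) : Type := Fin n × Set.Ici (-(m : ℤ))

/-- The inclusion of the kept indices into all indices. -/
def LeftIndex.incl {n m : ℕ} (p : LeftIndex n m) : Fin n × ℤ := (p.1, (p.2 : ℤ))

theorem LeftIndex.incl_injective {n m : ℕ} :
    Function.Injective (LeftIndex.incl : LeftIndex n m → Fin n × ℤ) := by
  rintro ⟨i, k⟩ ⟨j, l⟩ h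
  simp only [LeftIndex.incl, Prod.mk.injEq] at h
  exact Prod.ext h.1 (Subtype.ext h.2)

/-- The left `m`-truncation of a matrix: in every block, the rows and columns whose index is
strictly smaller than `-m` are deleted. -/
def leftTruncMatrix {n : ℕ} (m : ℕ) (M : Matrix (Fin n × ℤ) (Fin n × ℤ) ℂ) :
    Matrix (LeftIndex n m) (LeftIndex n m) ℂ :=
  M.submatrix LeftIndex.incl LeftIndex.incl

/-- The left `m`-truncation of a vector of `ℓ²`. -/
noncomputable def leftTruncVec {n : ℕ} (m : ℕ) (x : EllTwo (Fin n × ℤ)) :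
    EllTwo (LeftIndex n m) :=
  ⟨fun p => x p.incl, by
    have h2 : 0 < (2 : ENNReal).toReal := by norm_num
    have h := (memℓp_gen_iff h2).1 (lp.memℓp x)
    exact (memℓp_gen_iff h2).2 (h.comp_injective LeftIndex.incl_injective)⟩

/-- The (in general unbounded) operator on `ℓ²` defined by an infinite matrix, on its maximal
domain: the vectors `x` for which every row sum of `M x` converges and `M x` is in `ℓ²`. -/
noncomputable def matrixOp {ι : Type*} (M : Matrix ι ι ℂ) : EllTwo ι →ₗ.[ℂ] EllTwo ι where
  domain :=
    { carrier := {x | (∀ i, Summable fun j => M i j * x j) ∧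
        Memℓp (fun i => ∑' j, M i j * x j) 2}
      zero_mem' := by
        refine ⟨fun i => ?_, ?_⟩
        · simp
        · have h : Memℓp (0 : ι → ℂ) 2 := zero_memℓp
          convert h using 1
          funext i
          simp
      add_mem' := by
        rintro x y ⟨hx, hx'⟩ ⟨hy, hy'⟩
        have e : ∀ i j, M i j * (x + y) j = M i j * x j + M i j * y j := fun i j => by
          rw [lp.coeFn_add, Pi.add_apply, mul_add]
        refine ⟨fun i => ?_, ?_⟩
        · simpa only [e] using (hx i).add (hy i)
        · have h := hx'.add hy'
          convert h using 1
          funext i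
          simp only [e, Pi.add_apply]
          exact (hx i).tsum_add (hy i)
      smul_mem' := by
        rintro c x ⟨hx, hx'⟩
        have e : ∀ i j, M i j * (c • x) j = c * (M i j * x j) := fun i j => by
          rw [lp.coeFn_smul, Pi.smul_apply, smul_eq_mul]; ring
        refine ⟨fun i => ?_, ?_⟩
        · simpa only [e] using (hx i).mul_left c
        · have h := hx'.const_smul c
          convert h using 1
          funext i
          simp only [e, Pi.smul_apply, smul_eq_mul]
          exact tsum_mul_left }
  toFun :=
    { toFun := fun x => ⟨fun i => ∑' j, M i j * x.1 j, x.2.2⟩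
      map_add' := by
        intro x y
        ext i
        have e : ∀ j, M i j * (x.1 + y.1) j = M i j * x.1 j + M i j * y.1 j := fun j => by
          rw [lp.coeFn_add, Pi.add_apply, mul_add]
        simp only [Submodule.coe_add, lp.coeFn_add, Pi.add_apply]
        exact (tsum_congr e).trans ((x.2.1 i).tsum_add (y.2.1 i))
      map_smul' := by
        intro c x
        ext i
        have e : ∀ j, M i j * (c • x.1) j = c * (M i j * x.1 j) := fun j => by
          rw [lp.coeFn_smul, Pi.smul_apply, smul_eq_mul]; ring
        simp only [Submodule.coe_smul, lp.coeFn_smul, Pi.smul_apply, RingHom.id_apply,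
          smul_eq_mul]
        exact (tsum_congr e).trans tsum_mul_left }

/-- `z` is in the resolvent set of the unbounded operator `L`: the map `L - z` from the domain
of `L` to the whole space is bijective with a bounded inverse `R`. -/
def InResolventSet {H : Type*} [NormedAddCommGroup H] [NormedSpace ℂ H]
    (L : H →ₗ.[ℂ] H) (z : ℂ) : Prop :=
  ∃ R : H →L[ℂ] H,
    (∀ y : H, ∃ h : R y ∈ L.domain, L ⟨R y, h⟩ - z • R y = y) ∧
    ∀ x : L.domain, R (L x - z • (x : H)) = x

/-- The spectrum of an unbounded operator. -/
def opSpectrum {H : Type*} [NormedAddCommGroup H] [NormedSpace ℂ H]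
    (L : H →ₗ.[ℂ] H) : Set ℂ :=
  {z | ¬ InResolventSet L z}

/-- `x` is an eigenvector of the unbounded operator `L` for the eigenvalue `z`. -/
def IsEigenvector {H : Type*} [NormedAddCommGroup H] [NormedSpace ℂ H]
    (L : H →ₗ.[ℂ] H) (z : ℂ) (x : H) : Prop :=
  x ≠ 0 ∧ ∃ h : x ∈ L.domain, L ⟨x, h⟩ = z • x

/-- The set of eigenvalues of an unbounded operator. -/
def eigenvalues {H : Type*} [NormedAddCommGroup H] [NormedSpace ℂ H]
    (L : H →ₗ.[ℂ] H) : Set ℂ :=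
  {z | ∃ x, IsEigenvector L z x}

/-- The harmonic state operator `𝒜 - 𝒩` on `ℓ²`. -/
noncomputable def stateOp {n : ℕ} (T : ℝ) (A : ℝ → Matrix (Fin n) (Fin n) ℂ) :
    EllTwo (Fin n × ℤ) →ₗ.[ℂ] EllTwo (Fin n × ℤ) :=
  matrixOp (toeplitz T A - frequency n T)

/-- The left `m`-truncation of the harmonic state operator `𝒜 - 𝒩`. -/
noncomputable def leftTruncOp {n : ℕ} (T : ℝ) (A : ℝ → Matrix (Fin n) (Fin n) ℂ) (m : ℕ) :
    EllTwo (LeftIndex n m) →ₗ.[ℂ] EllTwo (LeftIndex n m) :=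
  matrixOp (leftTruncMatrix m (toeplitz T A - frequency n T))

/-- The set `{λ_p + jωk : k ∈ ℤ, p = 1, …, n}`. -/
def exponentSet {n : ℕ} (T : ℝ) (lam : Fin n → ℂ) : Set ℂ :=
  {z | ∃ (p : Fin n) (k : ℤ), z = lam p + Complex.I * (omega T : ℂ) * (k : ℂ)}

/-- The set `Λ₁⁺(m) = {λ_p + jωk : k ∈ ℤ, k ≤ m + 1 - j₀, p = 1, …, n}`. -/
def lambdaOne {n : ℕ} (T : ℝ) (lam : Fin n → ℂ) (j₀ m : ℕ) : Set ℂ :=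
  {z | ∃ (p : Fin n) (k : ℤ), k ≤ (m : ℤ) + 1 - (j₀ : ℤ) ∧
    z = lam p + Complex.I * (omega T : ℂ) * (k : ℂ)}

/-- The remaining eigenvalues `Λ₂⁺(m)`: the eigenvalues of the left `m`-truncation that are not
approximated up to `ε` by an element of `Λ₁⁺(m)`. -/
def lambdaTwo {n : ℕ} (T : ℝ) (A : ℝ → Matrix (Fin n) (Fin n) ℂ) (lam : Fin n → ℂ)
    (ε : ℝ) (j₀ m : ℕ) : Set ℂ :=
  {z | z ∈ eigenvalues (leftTruncOp T A m) ∧ ∀ w ∈ lambdaOne T lam j₀ m, ε ≤ dist z w}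

end HarmonicState

/-! The harmonic operator has the form `B - diag d`, where `B` is bounded (on the Fourier side it is
multiplication by `A`) and `d` is purely imaginary and tends to infinity. Since `(diag d + 1)⁻¹` is
compact, the equation `(B - diag d - z) x = y` becomes an equation for identity minus compact. By
the Fredholm alternative the spectrum consists of eigenvalues, and only finitely many lie in a
bounded set.

Shape of the spectrum. Translating the frequencies by `k` carries the operator to itself plus `jωk`,
so the spectrum is `jω`-periodic. An eigenvector has summable blocks, hence is the Fourier series of
a continuous `v`, and `exp (z t) v(t)` solves the integral form of `x' = A x`
(`Sol.signal_integral`). Uniqueness for that equation makes the initial values for distinct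
multipliers `exp (z T)` linearly independent in `ℂⁿ`, so there are at most `n` classes modulo `jω`
(`card_multipliers_le`). If `n > 0` there is at least one, for otherwise the resolvent would be a
bounded entire function that tends to zero along the real axis (`exists_isEig`).

Truncation. Let `P` be the projection onto the kept indices. Then `P B P` tends to `B` strongly with
norms at most `‖B‖`, and the compactness of `(diag d + 1)⁻¹` upgrades this to convergence of
eigenvalues on compact sets. Limits of approximate eigenvalues are eigenvalues (`isEig_of_tendsto`),
so nothing spurious survives, and the maximum principle for the resolvent shows that no eigenvalue
is lost (`eventually_exists_isEig_closedBall`).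

Uniformity in `m`. The truncations at `m` and `m'` are conjugate up to the shift `jω(m' - m)`
(`eigenvalues_leftTruncOp_shift`). An eigenvalue of low imaginary part at level `m` is thus one of
bounded imaginary part at a much larger level, where the convergence applies. This gives a `j₀`
independent of `m`, the finiteness of `Λ₂⁺` and its shift rule. The residual estimate is separate:
where `d i + z` is large an eigenvector satisfies `V i = (B V) i / (d i + z)`, so the deleted tail
is small, and the residual is the compression of `B` applied to that tail. -/

namespace HarmonicState

open MeasureTheory Filter Topology Set AddCircle

/-! ### Coordinate operators on `ℓ²`: restriction, extension by zero, diagonal operators. -/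

section EllTwoTools

variable {ι κ : Type*}

theorem two_toReal_pos : 0 < (2 : ENNReal).toReal := by norm_num

/-- Injectivity of `f` turns each finite partial sum for `y` into one for `x`. Most norm bounds
below are coordinatewise comparisons of this kind. -/
theorem EllTwo.norm_le_mul {x : EllTwo ι} {y : EllTwo κ} {C : ℝ} (hC : 0 ≤ C) (f : κ → ι)
    (hf : Function.Injective f) (h : ∀ k, ‖y k‖ ≤ C * ‖x (f k)‖) : ‖y‖ ≤ C * ‖x‖ := by
  refine lp.norm_le_of_forall_sum_le two_toReal_pos (by positivity) fun s => ?_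
  have h1 := lp.sum_rpow_le_norm_rpow two_toReal_pos x (s.map ⟨f, hf⟩)
  rw [Finset.sum_map] at h1
  rw [Real.mul_rpow hC (norm_nonneg _)]
  refine le_trans ?_ (mul_le_mul_of_nonneg_left h1 (by positivity))
  rw [Finset.mul_sum]
  refine Finset.sum_le_sum fun k _ => ?_
  rw [← Real.mul_rpow hC (norm_nonneg _)]
  exact Real.rpow_le_rpow (norm_nonneg _) (h k) (by norm_num)

theorem memℓp_two_comp {x : ι → ℂ} (hx : Memℓp x 2) {f : κ → ι} (hf : Function.Injective f) :
    Memℓp (fun k => x (f k)) 2 :=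
  (memℓp_gen_iff two_toReal_pos).2 (((memℓp_gen_iff two_toReal_pos).1 hx).comp_injective hf)

/-- Pulling a vector back along an injective map of indices. -/
noncomputable def pull (f : κ → ι) (hf : Function.Injective f) : EllTwo ι →L[ℂ] EllTwo κ :=
  LinearMap.mkContinuous
    { toFun := fun x => ⟨fun k => x (f k), memℓp_two_comp (lp.memℓp x) hf⟩
      map_add' := fun _ _ => rfl
      map_smul' := fun _ _ => rfl } 1
    fun x => EllTwo.norm_le_mul zero_le_one f hf fun k => by rw [one_mul]; exact le_rfl

@[simp] theorem pull_apply (f : κ → ι) (hf : Function.Injective f) (x : EllTwo ι) (k : κ) :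
    pull f hf x k = x (f k) := rfl

/-- Extending a vector by zero along an injective map of indices. -/
noncomputable def push (f : κ → ι) (hf : Function.Injective f) : EllTwo κ →L[ℂ] EllTwo ι :=
  ContinuousLinearMap.adjoint (pull f hf)

/-- Since `push` is an adjoint, its coordinates are read off by pairing with basis vectors. -/
theorem EllTwo.apply_eq_inner [DecidableEq ι] (x : EllTwo ι) (i : ι) :
    x i = inner ℂ (lp.single 2 i (1 : ℂ)) x := by
  rw [lp.inner_single_left]; simp

theorem push_apply [DecidableEq ι] (f : κ → ι) (hf : Function.Injective f) (y : EllTwo κ) (k : κ) :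
    push f hf y (f k) = y k := by
  classical
  rw [EllTwo.apply_eq_inner, push, ContinuousLinearMap.adjoint_inner_right,
    EllTwo.apply_eq_inner y k]
  congr 1
  ext l
  simp [lp.single_apply, Pi.single_apply, hf.eq_iff]

theorem push_apply_of_notMem [DecidableEq ι] (f : κ → ι) (hf : Function.Injective f) (y : EllTwo κ)
    {i : ι} (hi : i ∉ Set.range f) : push f hf y i = 0 := by
  rw [EllTwo.apply_eq_inner, push, ContinuousLinearMap.adjoint_inner_right]
  have : pull f hf (lp.single 2 i (1 : ℂ)) = 0 := by
    ext l
    have : f l ≠ i := fun h => hi ⟨l, h⟩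
    simp [lp.single_apply, this]
  rw [this, inner_zero_left]

/-- The diagonal operator with bounded entries `c i`. -/
noncomputable def diagOp (c : ι → ℂ) (C : ℝ) (hC : 0 ≤ C) (hc : ∀ i, ‖c i‖ ≤ C) :
    EllTwo ι →L[ℂ] EllTwo ι :=
  LinearMap.mkContinuous
    { toFun := fun x => ⟨fun i => c i * x i, by
        refine ((lp.memℓp x).const_smul (C : ℂ)).mono' fun i => ?_
        simp only [norm_mul, Pi.smul_apply, norm_smul, Complex.norm_real, Real.norm_eq_abs,
          abs_of_nonneg hC]
        exact mul_le_mul_of_nonneg_right (hc i) (norm_nonneg _)⟩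
      map_add' := fun x y => by ext i; exact mul_add _ _ _
      map_smul' := fun a x => by ext i; simp [mul_left_comm] } C
    fun x => EllTwo.norm_le_mul hC id Function.injective_id fun i => by
      simp only [LinearMap.coe_mk, AddHom.coe_mk, norm_mul, id]
      exact mul_le_mul_of_nonneg_right (hc i) (norm_nonneg _)

@[simp] theorem diagOp_apply (c : ι → ℂ) (C : ℝ) (hC : 0 ≤ C) (hc : ∀ i, ‖c i‖ ≤ C)
    (x : EllTwo ι) (i : ι) : diagOp c C hC hc x i = c i * x i := rfl

theorem continuous_ellTwo_apply (i : ι) : Continuous fun x : EllTwo ι => x i :=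
  (lp.lipschitzWith_one_eval 2 i).continuous

/-- Cutting off the entries smaller than `ε / 2` leaves finite rank, so the operator is a norm limit
of finite rank operators. -/
theorem diagOp_isCompactOperator (c : ι → ℂ) (C : ℝ) (hC : 0 ≤ C) (hc : ∀ i, ‖c i‖ ≤ C)
    (h0 : Tendsto (fun i => ‖c i‖) cofinite (𝓝 0)) : IsCompactOperator (diagOp c C hC hc) := by
  classical
  let P : ι → EllTwo ι →L[ℂ] EllTwo ι := fun i =>
    c i • (lp.singleContinuousLinearMap ℂ (fun _ : ι => ℂ) 2 i).comp (lp.evalCLM ℂ (fun _ : ι => ℂ) 2 i)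
  have hP : ∀ i, IsCompactOperator (P i) := fun i => by
    refine IsCompactOperator.smul ?_ (c i)
    have h : IsCompactOperator (lp.evalCLM ℂ (fun _ : ι => ℂ) 2 i) :=
      isCompactOperator_of_locallyCompactSpace_dom _
    exact h.clm_comp (lp.singleContinuousLinearMap ℂ (fun _ : ι => ℂ) 2 i)
  have hmem : diagOp c C hC hc ∈
      closure {f : EllTwo ι →L[ℂ] EllTwo ι | IsCompactOperator f} := by
    rw [Metric.mem_closure_iff]
    intro ε hε
    have hfin : {i | ¬ ‖c i‖ < ε / 2}.Finite := h0.eventually (gt_mem_nhds (half_pos hε))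
    refine ⟨∑ i ∈ hfin.toFinset, P i, ?_, ?_⟩
    · exact Submodule.sum_mem (compactOperator (RingHom.id ℂ) (EllTwo ι) (EllTwo ι)) fun i _ => hP i
    · rw [dist_eq_norm]
      refine lt_of_le_of_lt (ContinuousLinearMap.opNorm_le_bound _ (half_pos hε).le fun x => ?_)
        (half_lt_self hε)
      refine EllTwo.norm_le_mul (half_pos hε).le id Function.injective_id fun i => ?_
      have : (diagOp c C hC hc - ∑ i ∈ hfin.toFinset, P i) x i =
          if ‖c i‖ < ε / 2 then c i * x i else 0 := by
        simp only [sub_apply, sum_apply, lp.coeFn_sub,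
          lp.coeFn_sum, Pi.sub_apply, Finset.sum_apply, diagOp_apply]
        have h1 : ∀ j, (P j x) i = if i = j then c i * x i else 0 := fun j => by
          simp only [P]
          by_cases hij : i = j
          · subst hij; simp [lp.evalCLM]
          · simp [hij, lp.single_apply]
        simp only [h1, Finset.sum_ite_eq, Finite.mem_toFinset, mem_ofPred_eq]
        split_ifs <;> simp_all
      rw [this]
      split_ifs with h
      · rw [norm_mul]; exact mul_le_mul_of_nonneg_right h.le (norm_nonneg _)
      · simp; positivity
  rwa [isClosed_setOfPred_isCompactOperator.closure_eq] at hmem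

end EllTwoTools

/-! ### Discreteness of the nonzero eigenvalues of a compact operator. -/

section CompactEigenvalues

open InnerProductSpace in
/-- The eigenvalues of a compact operator do not accumulate away from `0`. -/
theorem finite_eigenvalues_of_isCompactOperator {H : Type*} [NormedAddCommGroup H]
    [InnerProductSpace ℂ H] (R : H →L[ℂ] H) (hR : IsCompactOperator R) {δ : ℝ} (hδ : 0 < δ) :
    {ν : ℂ | δ ≤ ‖ν‖ ∧ ∃ x : H, x ≠ 0 ∧ R x = ν • x}.Finite := by
  by_contra hinf
  let ν := Set.Infinite.natEmbedding _ hinf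
  choose v hv0 hv using fun k => (ν k).2.2
  have hli : LinearIndependent ℂ v := by
    refine Module.End.eigenvectors_linearIndependent' (R : Module.End ℂ H) (fun k => (ν k : ℂ))
      (fun a b h => ν.injective (Subtype.ext h)) v fun k => ?_
    exact ⟨Module.End.mem_eigenspace_iff.2 (hv k), hv0 k⟩
  -- In the orthonormalised eigenvectors `R` is upper triangular with diagonal `ν k`. Pairing with
  -- `e k` shows that the images `R (e k)` are at mutual distance at least `δ`, so they have no
  -- convergent subsequence.
  let e := gramSchmidtNormed ℂ v
  have he : Orthonormal ℂ e := gramSchmidtNormed_orthonormal hli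
  have hinv : ∀ k, ∀ x ∈ Submodule.span ℂ (v '' Set.Iio k), R x ∈ Submodule.span ℂ (v '' Set.Iio k) := by
    intro k x hx
    have : Submodule.span ℂ (v '' Set.Iio k) ≤ (Submodule.span ℂ (v '' Set.Iio k)).comap
        (R : H →ₗ[ℂ] H) := by
      rw [Submodule.span_le]
      rintro _ ⟨j, hj, rfl⟩
      have : R (v j) ∈ Submodule.span ℂ (v '' Set.Iio k) := by
        rw [hv j]
        exact Submodule.smul_mem _ _ (Submodule.subset_span ⟨j, hj, rfl⟩)
      exact this
    exact this hx
  have hIio : ∀ k, Submodule.span ℂ (v '' Set.Iio k) = Submodule.span ℂ (e '' Set.Iio k) := fun k => by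
    rw [span_gramSchmidtNormed, span_gramSchmidt_Iio]
  have horth : ∀ k, ∀ x ∈ Submodule.span ℂ (v '' Set.Iio k), inner ℂ (e k) x = 0 := by
    intro k x hx
    rw [hIio] at hx
    induction hx using Submodule.span_induction with
    | mem x hx =>
      obtain ⟨j, hj, rfl⟩ := hx
      exact he.2 (ne_of_gt hj)
    | zero => simp
    | add x y _ _ hx hy => rw [inner_add_right, hx, hy, add_zero]
    | smul a x _ hx => rw [inner_smul_right, hx, mul_zero]
  have hmem : ∀ k, ∃ c : ℂ, e k - c • v k ∈ Submodule.span ℂ (v '' Set.Iio k) := by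
    intro k
    have h1 : e k ∈ Submodule.span ℂ (v '' Set.Iic k) := by
      rw [← span_gramSchmidt_Iic, ← span_gramSchmidtNormed]
      exact Submodule.subset_span ⟨k, Set.mem_Iic.2 le_rfl, rfl⟩
    rw [← Set.Iio_insert, Set.image_insert_eq, Submodule.mem_span_insert] at h1
    obtain ⟨a, z, hz, h⟩ := h1
    exact ⟨a, by rw [h]; simpa using hz⟩
  have hdiag : ∀ k, inner ℂ (e k) (R (e k)) = (ν k : ℂ) := by
    intro k
    obtain ⟨c, hc⟩ := hmem k
    have h1 : R (e k) - (ν k : ℂ) • e k ∈ Submodule.span ℂ (v '' Set.Iio k) := by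
      have : R (e k) - (ν k : ℂ) • e k = R (e k - c • v k) - (ν k : ℂ) • (e k - c • v k) := by
        rw [map_sub, map_smul, hv, smul_sub, smul_comm c]
        abel
      rw [this]
      exact Submodule.sub_mem _ (hinv k _ hc) (Submodule.smul_mem _ _ hc)
    have h2 := horth k _ h1
    rw [inner_sub_right, inner_smul_right, inner_self_eq_norm_sq_to_K, he.1 k] at h2
    simpa [sub_eq_zero] using h2
  have hoff : ∀ j k, j < k → inner ℂ (e k) (R (e j)) = 0 := by
    intro j k hjk
    refine horth k _ (hinv k _ ?_)
    rw [hIio]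
    exact Submodule.subset_span ⟨j, hjk, rfl⟩
  have hsep : ∀ j k, j < k → δ ≤ ‖R (e k) - R (e j)‖ := by
    intro j k hjk
    have h1 : ‖inner ℂ (e k) (R (e k) - R (e j))‖ ≤ ‖e k‖ * ‖R (e k) - R (e j)‖ :=
      norm_inner_le_norm _ _
    rw [inner_sub_right, hdiag, hoff j k hjk, sub_zero, he.1 k, one_mul] at h1
    exact (ν k).2.1.trans h1
  obtain ⟨K, hK, hK'⟩ := hR.image_closedBall_subset_compact (1 : ℝ)
  obtain ⟨y, -, ψ, hψ, hψy⟩ := hK.tendsto_subseq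
    (fun k => hK' ⟨e k, by simp [he.1 k], rfl⟩)
  have hc := hψy.cauchySeq
  rw [Metric.cauchySeq_iff'] at hc
  obtain ⟨N, hN⟩ := hc δ hδ
  have h1 := hN (N + 1) (Nat.le_succ N)
  rw [dist_eq_norm] at h1
  exact absurd h1 (not_lt.2 (hsep _ _ (hψ (Nat.lt_succ_self N))))

end CompactEigenvalues

/-! ### Bounded perturbations of an imaginary diagonal: Fredholm reduction and resolvent. -/

section DiagonalPerturbation

variable {ι : Type*}

/-- `y = (B - diag d - z) x`. -/
def Sol (B : EllTwo ι →L[ℂ] EllTwo ι) (d : ι → ℂ) (z : ℂ) (x y : EllTwo ι) : Prop :=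
  ∀ i, B x i - (d i + z) * x i = y i

/-- `z` is an eigenvalue of `B - diag d`. -/
def IsEig (B : EllTwo ι →L[ℂ] EllTwo ι) (d : ι → ℂ) (z : ℂ) : Prop :=
  ∃ x, x ≠ 0 ∧ Sol B d z x 0

theorem Sol.smul {B : EllTwo ι →L[ℂ] EllTwo ι} {d : ι → ℂ} {z : ℂ} {x y : EllTwo ι}
    (h : Sol B d z x y) (a : ℂ) : Sol B d z (a • x) (a • y) := fun i => by
  rw [map_smul]
  simp only [lp.coeFn_smul, Pi.smul_apply, smul_eq_mul, ← h i]
  ring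

theorem Sol.change {B : EllTwo ι →L[ℂ] EllTwo ι} {d : ι → ℂ} {z : ℂ} {x y : EllTwo ι}
    (h : Sol B d z x y) (b : ℂ) : Sol B d b x (y + (z - b) • x) := fun i => by
  simp only [lp.coeFn_add, lp.coeFn_smul, Pi.add_apply, Pi.smul_apply, smul_eq_mul, ← h i]
  ring

/-- The norm of a solution away from the frequencies. -/
theorem Sol.norm_le {B : EllTwo ι →L[ℂ] EllTwo ι} {d : ι → ℂ} {z : ℂ} {x y : EllTwo ι}
    (h : Sol B d z x y) {ρ : ℝ} (hρ : 0 < ρ) (hi : ∀ i, ρ ≤ ‖d i + z‖) :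
    ρ * ‖x‖ ≤ ‖B‖ * ‖x‖ + ‖y‖ := by
  have h1 : ‖x‖ ≤ ρ⁻¹ * ‖B x - y‖ := by
    refine EllTwo.norm_le_mul (inv_nonneg.2 hρ.le) id Function.injective_id fun i => ?_
    rw [← div_eq_inv_mul, le_div_iff₀ hρ]
    have : (B x - y) i = (d i + z) * x i := by
      simp only [lp.coeFn_sub, Pi.sub_apply, ← h i]; ring
    rw [id, this, norm_mul, mul_comm]
    exact mul_le_mul_of_nonneg_right (hi i) (norm_nonneg _)
  rw [← div_eq_inv_mul, le_div_iff₀ hρ] at h1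
  calc ρ * ‖x‖ ≤ ‖B x - y‖ := by rwa [mul_comm]
    _ ≤ ‖B x‖ + ‖y‖ := norm_sub_le _ _
    _ ≤ _ := by gcongr; exact B.le_opNorm x

/-- Eigenvalues stay within `‖B‖ + 1` of the points `-d i`. This confines them to a vertical strip
and later bounds the imaginary parts for a truncation. -/
theorem IsEig.exists_norm_lt {B : EllTwo ι →L[ℂ] EllTwo ι} {d : ι → ℂ} {z : ℂ}
    (h : IsEig B d z) : ∃ i, ‖d i + z‖ < ‖B‖ + 1 := by
  by_contra! hi
  obtain ⟨x, hx, hs⟩ := h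
  have h1 := hs.norm_le (by positivity : 0 < ‖B‖ + 1) hi
  have h2 : 0 < ‖x‖ := norm_pos_iff.2 hx
  rw [norm_zero] at h1
  linarith

variable {d : ι → ℂ} (hd : ∀ i, (d i).re = 0)

include hd in
theorem abs_re_le_norm_add (z : ℂ) (i : ι) : |z.re| ≤ ‖d i + z‖ := by
  have := Complex.abs_re_le_norm (d i + z)
  rwa [Complex.add_re, hd i, zero_add] at this

include hd in
theorem IsEig.abs_re_lt {B : EllTwo ι →L[ℂ] EllTwo ι} {z : ℂ}
    (h : IsEig B d z) : |z.re| < ‖B‖ + 1 := by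
  obtain ⟨i, hi⟩ := h.exists_norm_lt
  exact (abs_re_le_norm_add hd z i).trans_lt hi

include hd in
-- The entries `d i` are imaginary, so adding `1` always gives an invertible diagonal whose inverse
-- is a contraction.
theorem one_le_norm_add_one (i : ι) : 1 ≤ ‖d i + 1‖ := by
  simpa using abs_re_le_norm_add hd 1 i

/-- The operator `(diag d + 1)⁻¹`. -/
noncomputable def invDiag : EllTwo ι →L[ℂ] EllTwo ι :=
  diagOp (fun i => (d i + 1)⁻¹) 1 zero_le_one fun i => by
    rw [norm_inv]; exact inv_le_one_of_one_le₀ (one_le_norm_add_one hd i)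

theorem eq_invDiag_iff (x w : EllTwo ι) :
    x = invDiag hd w ↔ ∀ i, (d i + 1) * x i = w i := by
  have h0 : ∀ i, d i + 1 ≠ 0 := fun i h => by
    have := one_le_norm_add_one hd i
    rw [h, norm_zero] at this; linarith
  constructor
  · rintro rfl i
    exact mul_inv_cancel_left₀ (h0 i) _
  · intro h
    ext i
    change x i = (d i + 1)⁻¹ * w i
    rw [← h i, inv_mul_cancel_left₀ (h0 i)]

theorem sol_iff_invDiag (B : EllTwo ι →L[ℂ] EllTwo ι) (z : ℂ) (x y : EllTwo ι) :
    Sol B d z x y ↔ x = invDiag hd (B x + (1 - z) • x - y) := by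
  rw [eq_invDiag_iff]
  refine forall_congr' fun i => ?_
  simp only [lp.coeFn_sub, lp.coeFn_add, lp.coeFn_smul, Pi.sub_apply, Pi.add_apply, Pi.smul_apply,
    smul_eq_mul]
  constructor <;> intro h <;> linear_combination -h

theorem invDiag_isCompactOperator (hd' : Tendsto (fun i => ‖d i‖) cofinite atTop) :
    IsCompactOperator (invDiag hd) := by
  refine diagOp_isCompactOperator _ _ _ _ ?_
  simp only [norm_inv]
  refine tendsto_inv_atTop_zero.comp (tendsto_atTop_mono (fun i => ?_)
    (tendsto_atTop_add_const_right _ (-1 : ℝ) hd'))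
  have := norm_sub_norm_le (d i) (-1)
  simp only [norm_neg, norm_one, sub_neg_eq_add] at this
  linarith

/-- The compact operator `(diag d + 1)⁻¹ (B + 1 - z)`. -/
noncomputable def fixOp (B : EllTwo ι →L[ℂ] EllTwo ι) (z : ℂ) : EllTwo ι →L[ℂ] EllTwo ι :=
  invDiag hd * (B + (1 - z) • 1)

theorem sol_iff_fixOp (B : EllTwo ι →L[ℂ] EllTwo ι) (z : ℂ) (x y : EllTwo ι) :
    Sol B d z x y ↔ (1 - fixOp hd B z) x = -invDiag hd y := by
  rw [sol_iff_invDiag hd, map_sub]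
  change x = fixOp hd B z x - _ ↔ x - fixOp hd B z x = _
  constructor <;> intro h
  · linear_combination (norm := module) h
  · linear_combination (norm := module) h

/-- The resolvent of `B - diag d`. -/
noncomputable def resolv (B : EllTwo ι →L[ℂ] EllTwo ι) (z : ℂ) : EllTwo ι →L[ℂ] EllTwo ι :=
  -(Ring.inverse (1 - fixOp hd B z) * invDiag hd)

/-- Fredholm alternative for the compact operator `fixOp` at the value `1`: a fixed vector would be
an eigenvector of `B - diag d`. -/
theorem isUnit_of_not_isEig (hd' : Tendsto (fun i => ‖d i‖) cofinite atTop)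
    {B : EllTwo ι →L[ℂ] EllTwo ι} {z : ℂ} (h : ¬ IsEig B d z) : IsUnit (1 - fixOp hd B z) := by
  have hc : IsCompactOperator (fixOp hd B z) :=
    (invDiag_isCompactOperator hd hd').comp_clm _
  rcases hc.hasEigenvalue_or_mem_resolventSet (one_ne_zero (α := ℂ)) with h1 | h1
  · obtain ⟨x, hx⟩ := h1.exists_hasEigenvector
    refine absurd ⟨x, hx.2, (sol_iff_fixOp hd B z x 0).2 ?_⟩ h
    have : fixOp hd B z x = x := by simpa using hx.apply_eq_smul
    simp [this]
  · simpa using! spectrum.mem_resolventSet_iff.1 h1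

theorem sol_iff_resolv {B : EllTwo ι →L[ℂ] EllTwo ι} {z : ℂ}
    (h : IsUnit (1 - fixOp hd B z)) (x y : EllTwo ι) :
    Sol B d z x y ↔ x = resolv hd B z y := by
  rw [sol_iff_fixOp hd]
  have h1 := Ring.inverse_mul_cancel _ h
  have h2 := Ring.mul_inverse_cancel _ h
  constructor
  · intro hx
    have : (Ring.inverse (1 - fixOp hd B z) * (1 - fixOp hd B z)) x = x := by rw [h1]; rfl
    rw [← this]
    change Ring.inverse (1 - fixOp hd B z) ((1 - fixOp hd B z) x) =
      -(Ring.inverse (1 - fixOp hd B z) (invDiag hd y))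
    rw [hx, map_neg]
  · rintro rfl
    change (1 - fixOp hd B z) (-(Ring.inverse (1 - fixOp hd B z) (invDiag hd y))) = _
    rw [map_neg]
    congr 1
    change ((1 - fixOp hd B z) * Ring.inverse (1 - fixOp hd B z)) (invDiag hd y) = _
    rw [h2]; rfl

theorem differentiableAt_resolv {B : EllTwo ι →L[ℂ] EllTwo ι} {z : ℂ}
    (h : IsUnit (1 - fixOp hd B z)) : DifferentiableAt ℂ (resolv hd B) z := by
  have h1 : DifferentiableAt ℂ (fun w => 1 - fixOp hd B w) z := by
    unfold fixOp
    fun_prop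
  have h2 : DifferentiableAt ℂ (Ring.inverse : (EllTwo ι →L[ℂ] EllTwo ι) → _)
      (1 - fixOp hd B z) := differentiableAt_inverse h
  have h3 := h2.comp z h1
  exact (h3.mul_const (invDiag hd)).neg

end DiagonalPerturbation

/-! ### Eigenvalues under strong convergence, discreteness and existence. -/

section StrongLimits

variable {ι : Type*} {d : ι → ℂ} (hd : ∀ i, (d i).re = 0)
  (hd' : Tendsto (fun i => ‖d i‖) cofinite atTop)

include hd hd' in
/-- A limit of approximate eigenvalues is an eigenvalue. -/
theorem isEig_of_tendsto {B : EllTwo ι →L[ℂ] EllTwo ι} {Bs : ℕ → EllTwo ι →L[ℂ] EllTwo ι} {C : ℝ}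
    (hC : ∀ j, ‖Bs j‖ ≤ C) (hB : ∀ x, Tendsto (fun j => Bs j x) atTop (𝓝 (B x)))
    {zs : ℕ → ℂ} {z : ℂ} (hz : Tendsto zs atTop (𝓝 z)) {xs ys : ℕ → EllTwo ι}
    (hx : ∀ j, ‖xs j‖ = 1) (hs : ∀ j, Sol (Bs j) d (zs j) (xs j) (ys j))
    (hy : Tendsto ys atTop (𝓝 0)) : IsEig B d z := by
  obtain ⟨C1, hC1⟩ := (hy.norm.bddAbove_range)
  obtain ⟨C2, hC2⟩ := (hz.norm.bddAbove_range)
  have hC1 : ∀ j, ‖ys j‖ ≤ C1 := fun j => hC1 ⟨j, rfl⟩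
  have hC2 : ∀ j, ‖zs j‖ ≤ C2 := fun j => hC2 ⟨j, rfl⟩
  let w : ℕ → EllTwo ι := fun j => Bs j (xs j) + (1 - zs j) • xs j - ys j
  have hw : ∀ j, ‖w j‖ ≤ C + (1 + C2) + C1 := fun j => by
    have h1 : ‖Bs j (xs j)‖ ≤ C := by
      have := (Bs j).le_opNorm (xs j)
      rw [hx j, mul_one] at this
      exact this.trans (hC j)
    have h2 : ‖(1 - zs j) • xs j‖ ≤ 1 + C2 := by
      rw [norm_smul, hx j, mul_one]
      refine (norm_sub_le _ _).trans ?_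
      rw [norm_one]
      linarith [hC2 j]
    exact (norm_sub_le _ _).trans (add_le_add ((norm_add_le _ _).trans (add_le_add h1 h2)) (hC1 j))
  -- Each `xs j` is the image of the bounded vector `w j` under a compact operator. A subsequence
  -- therefore converges in norm, which keeps the limit of norm one.
  obtain ⟨K, hK, hK'⟩ := (invDiag_isCompactOperator hd hd').image_closedBall_subset_compact
    (C + (1 + C2) + C1)
  obtain ⟨x, -, φ, hφ, hφx⟩ := hK.tendsto_subseq (fun j => hK' ⟨w j, by simpa using hw j, rfl⟩)
  have hxs : ∀ j, invDiag hd (w j) = xs j := fun j => ((sol_iff_invDiag hd _ _ _ _).1 (hs j)).symm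
  replace hφx : Tendsto (fun j => xs (φ j)) atTop (𝓝 x) := by
    exact hφx.congr fun j => hxs (φ j)
  have hx1 : ‖x‖ = 1 := by
    refine tendsto_nhds_unique hφx.norm ?_
    simp only [hx]
    exact tendsto_const_nhds
  refine ⟨x, fun h => by simp [h] at hx1, fun i => ?_⟩
  have hBx : Tendsto (fun j => Bs (φ j) (xs (φ j))) atTop (𝓝 (B x)) := by
    have h1 : Tendsto (fun j => Bs (φ j) (xs (φ j) - x)) atTop (𝓝 0) := by
      have h2 : Tendsto (fun j => C * ‖xs (φ j) - x‖) atTop (𝓝 0) := by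
        have := (tendsto_iff_norm_sub_tendsto_zero.1 hφx).const_mul C
        rwa [mul_zero] at this
      refine squeeze_zero_norm (fun j => ?_) h2
      exact ((Bs (φ j)).le_opNorm _).trans (mul_le_mul_of_nonneg_right (hC _) (norm_nonneg _))
    have h3 := h1.add ((hB x).comp hφ.tendsto_atTop)
    simp only [zero_add, Function.comp_def, ← map_add, sub_add_cancel] at h3
    exact h3
  have e : ∀ {u : ℕ → EllTwo ι} {v : EllTwo ι}, Tendsto u atTop (𝓝 v) →
      Tendsto (fun j => u j i) atTop (𝓝 (v i)) := fun h =>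
    ((continuous_ellTwo_apply i).tendsto _).comp h
  have h4 := (e hBx).sub (((hz.comp hφ.tendsto_atTop).const_add (d i)).mul (e hφx))
  have h5 := e (hy.comp hφ.tendsto_atTop)
  refine tendsto_nhds_unique h4 (h5.congr fun j => ?_)
  exact (hs (φ j) i).symm

variable {B : EllTwo ι →L[ℂ] EllTwo ι} {Bs : ℕ → EllTwo ι →L[ℂ] EllTwo ι} {C : ℝ}
    (hC : ∀ j, ‖Bs j‖ ≤ C) (hB : ∀ x, Tendsto (fun j => Bs j x) atTop (𝓝 (B x)))

include hd hd' hC hB in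
/-- Uniform resolvent bounds on a compact set without eigenvalues of the limit. -/
theorem exists_lower_bound {S : Set ℂ} (hS : IsCompact S) (hSB : ∀ z ∈ S, ¬ IsEig B d z) :
    ∃ δ > 0, ∀ᶠ j in atTop, ∀ z ∈ S, ∀ x y, Sol (Bs j) d z x y → δ * ‖x‖ ≤ ‖y‖ := by
  by_contra! hcon
  have h1 : ∀ N : ℕ, ∃ᶠ j in atTop, ∃ z ∈ S, ∃ x y, Sol (Bs j) d z x y ∧
      ‖y‖ < (1 / ((N : ℝ) + 1)) * ‖x‖ := fun N => by
    have := hcon (1 / ((N : ℝ) + 1)) (by positivity)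
    exact this
  obtain ⟨φ, hφ, h2⟩ := Filter.extraction_forall_of_frequently h1
  choose z hzS x y hs hlt using h2
  obtain ⟨w, hwS, ψ, hψ, hψw⟩ := hS.tendsto_subseq hzS
  have hx0 : ∀ j, 0 < ‖x j‖ := fun j => by
    by_contra h
    have h0 : ‖x j‖ = 0 := le_antisymm (not_lt.1 h) (norm_nonneg _)
    have := hlt j
    rw [h0, mul_zero] at this
    exact absurd this (not_lt.2 (norm_nonneg _))
  refine hSB w hwS (isEig_of_tendsto hd hd' (Bs := fun j => Bs (φ (ψ j)))
    (xs := fun j => ((‖x (ψ j)‖ : ℂ))⁻¹ • x (ψ j)) (ys := fun j => ((‖x (ψ j)‖ : ℂ))⁻¹ • y (ψ j))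
    (fun j => hC _)
    (fun x => (hB x).comp (hφ.comp hψ).tendsto_atTop) hψw (fun j => ?_) (fun j => (hs _).smul _) ?_)
  · rw [norm_smul, norm_inv, Complex.norm_real, norm_norm, inv_mul_cancel₀ (hx0 _).ne']
  · refine squeeze_zero_norm (fun j => ?_) (tendsto_one_div_add_atTop_nhds_zero_nat.comp
      hψ.tendsto_atTop)
    rw [norm_smul, norm_inv, Complex.norm_real, norm_norm, ← div_eq_inv_mul, div_le_iff₀ (hx0 _)]
    exact (hlt _).le

include hd hd' hC hB in
/-- On a compact set, the eigenvalues of `Bs j - diag d` are close to those of the limit. -/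
theorem eventually_exists_isEig_near {S : Set ℂ} (hS : IsCompact S) {ε : ℝ} (hε : 0 < ε) :
    ∀ᶠ j in atTop, ∀ z ∈ S, IsEig (Bs j) d z → ∃ w, IsEig B d w ∧ dist z w < ε := by
  have hS' : IsCompact (S ∩ {z | ∃ w, IsEig B d w ∧ dist z w < ε}ᶜ) := by
    refine hS.inter_right (IsOpen.isClosed_compl ?_)
    have : {z | ∃ w, IsEig B d w ∧ dist z w < ε} = ⋃ w ∈ {w | IsEig B d w}, Metric.ball w ε := by
      ext z; simp
    rw [this]
    exact isOpen_biUnion fun _ _ => Metric.isOpen_ball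
  obtain ⟨δ, hδ, h⟩ := exists_lower_bound hd hd' hC hB hS' fun z hz hzB =>
    hz.2 ⟨z, hzB, by simpa using hε⟩
  filter_upwards [h] with j hj z hz hzj
  by_contra hcon
  obtain ⟨x, hx, hs⟩ := hzj
  have h1 := hj z ⟨hz, hcon⟩ x 0 hs
  rw [norm_zero] at h1
  have := mul_pos hδ (norm_pos_iff.2 hx)
  linarith

include hd hd' hC hB in
/-- Every eigenvalue of the limit enclosed by a circle without eigenvalues is approximated. -/
theorem eventually_exists_isEig_closedBall {z₀ : ℂ} (h₀ : IsEig B d z₀) {r : ℝ} (hr : 0 < r)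
    (hcirc : ∀ z ∈ Metric.sphere z₀ r, ¬ IsEig B d z) :
    ∀ᶠ j in atTop, ∃ z ∈ Metric.closedBall z₀ r, IsEig (Bs j) d z := by
  obtain ⟨V, hV, hsV⟩ := h₀
  obtain ⟨δ, hδ, h⟩ := exists_lower_bound hd hd' hC hB (isCompact_sphere z₀ r) hcirc
  have hlim : Tendsto (fun j => ‖Bs j V - B V‖) atTop (𝓝 0) :=
    tendsto_iff_norm_sub_tendsto_zero.1 (hB V)
  have hVpos : 0 < δ * ‖V‖ := mul_pos hδ (norm_pos_iff.2 hV)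
  filter_upwards [h, hlim.eventually (gt_mem_nhds hVpos)] with j hj hjV
  by_contra! hcon
  -- Without eigenvalues in the disc, the resolvent of `Bs j` is holomorphic there, and its bound
  -- `δ⁻¹` on the circle passes to the centre. But `V` solves the equation at `z₀` with the small
  -- right side `Bs j V - B V`, which contradicts that bound.
  have hunit : ∀ z ∈ Metric.closedBall z₀ r, IsUnit (1 - fixOp hd (Bs j) z) := fun z hz =>
    isUnit_of_not_isEig hd hd' (hcon z hz)
  have hdiff : DiffContOnCl ℂ (resolv hd (Bs j)) (Metric.ball z₀ r) := by
    refine DifferentiableOn.diffContOnCl fun z hz => ?_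
    rw [closure_ball z₀ hr.ne'] at hz
    exact (differentiableAt_resolv hd (hunit z hz)).differentiableWithinAt
  have hbd : ∀ z ∈ frontier (Metric.ball z₀ r), ‖resolv hd (Bs j) z‖ ≤ δ⁻¹ := by
    intro z hz
    rw [frontier_ball z₀ hr.ne'] at hz
    refine ContinuousLinearMap.opNorm_le_bound _ (inv_nonneg.2 hδ.le) fun y => ?_
    rw [← div_eq_inv_mul, le_div_iff₀ hδ, mul_comm]
    exact hj z hz _ y ((sol_iff_resolv hd (hunit z (Metric.sphere_subset_closedBall hz)) _ _).2 rfl)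
  have hz₀ : ‖resolv hd (Bs j) z₀‖ ≤ δ⁻¹ :=
    Complex.norm_le_of_forall_mem_frontier_norm_le Metric.isBounded_ball hdiff hbd
      (subset_closure (Metric.mem_ball_self hr))
  have hsol : Sol (Bs j) d z₀ V (Bs j V - B V) := fun i => by
    have := hsV i
    simp only [lp.coeFn_zero, Pi.zero_apply, lp.coeFn_sub, Pi.sub_apply] at this ⊢
    linear_combination this
  have h1 := (sol_iff_resolv hd (hunit z₀ (Metric.mem_closedBall_self hr.le)) _ _).1 hsol
  have h2 : ‖V‖ ≤ δ⁻¹ * ‖Bs j V - B V‖ := by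
    calc ‖V‖ = ‖resolv hd (Bs j) z₀ (Bs j V - B V)‖ := by rw [← h1]
      _ ≤ ‖resolv hd (Bs j) z₀‖ * ‖Bs j V - B V‖ := ContinuousLinearMap.le_opNorm _ _
      _ ≤ _ := by gcongr
  rw [← div_eq_inv_mul, le_div_iff₀ hδ] at h2
  linarith

include hd hd' in
/-- The eigenvalues in a bounded set are finitely many. -/
theorem finite_isEig_inter (B : EllTwo ι →L[ℂ] EllTwo ι) {S : Set ℂ} (hS : Bornology.IsBounded S) :
    {z | IsEig B d z ∧ z ∈ S}.Finite := by
  obtain ⟨M, hM0, hM⟩ := hS.exists_pos_norm_le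
  -- A base point outside the strip of eigenvalues. Eigenvalues `z` correspond to eigenvalues `(z -
  -- b)⁻¹` of the compact resolvent at `b`, and bounded `z` keep these away from `0`.
  let b : ℂ := ((‖B‖ + 1 : ℝ) : ℂ)
  have hbnorm : ‖b‖ = ‖B‖ + 1 := by
    rw [Complex.norm_real, Real.norm_eq_abs, abs_of_pos (by positivity)]
  have hb : ¬ IsEig B d b := fun h => by
    have h1 := h.abs_re_lt hd
    rw [Complex.ofReal_re, abs_of_pos (by positivity)] at h1
    exact lt_irrefl _ h1
  have hu := isUnit_of_not_isEig hd hd' hb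
  have hcomp : IsCompactOperator (resolv hd B b) := by
    have h1 := (invDiag_isCompactOperator hd hd').clm_comp (-Ring.inverse (1 - fixOp hd B b))
    exact h1
  have hbpos : 0 < ‖b‖ := by rw [hbnorm]; positivity
  have hfin := finite_eigenvalues_of_isCompactOperator _ hcomp
    (δ := (M + ‖b‖)⁻¹) (by positivity)
  refine (hfin.image fun ν => b + (ν⁻¹ : ℂ) ).subset ?_
  rintro z ⟨⟨x, hx, hs⟩, hz⟩
  have hzb : z - b ≠ 0 := fun h => hb ⟨x, hx, by rwa [← sub_eq_zero.1 h]⟩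
  refine ⟨(z - b)⁻¹, ⟨?_, x, hx, ?_⟩, ?_⟩
  · rw [norm_inv]
    refine inv_anti₀ (norm_pos_iff.2 hzb) ((norm_sub_le _ _).trans ?_)
    linarith [hM z hz]
  · have h1 := hs.change b
    rw [zero_add, sol_iff_resolv hd hu, map_smul] at h1
    nth_rw 2 [h1]
    rw [smul_smul, inv_mul_cancel₀ hzb, one_smul]
  · simp

include hd hd' in
/-- If the eigenvalue equation has a period and the space is not trivial, there is an eigenvalue. -/
theorem exists_isEig [Nonempty ι] (B : EllTwo ι →L[ℂ] EllTwo ι) {ω : ℝ} (hω : 0 < ω)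
    (S : ℤ → EllTwo ι → EllTwo ι) (hSn : ∀ k x, ‖S k x‖ = ‖x‖)
    (hS : ∀ (k : ℤ) (z : ℂ) x y, Sol B d z x y → Sol B d (z + Complex.I * ω * k) (S k x) (S k y)) :
    ∃ z, IsEig B d z := by
  classical
  -- Liouville's argument: the resolvent would be entire, small for large `|z.re|`, and bounded
  -- elsewhere because the period reduces the strip to a compact rectangle. Hence it would vanish
  -- identically.
  by_contra! hno
  have hu : ∀ z, IsUnit (1 - fixOp hd B z) := fun z => isUnit_of_not_isEig hd hd' (hno z)
  have hsol : ∀ z y, Sol B d z (resolv hd B z y) y := fun z y => (sol_iff_resolv hd (hu z) _ _).2 rfl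
  have hdiff : Differentiable ℂ (resolv hd B) := fun z => differentiableAt_resolv hd (hu z)
  have hfar : ∀ z : ℂ, ‖B‖ + 1 ≤ |z.re| → ‖resolv hd B z‖ ≤ (|z.re| - ‖B‖)⁻¹ := by
    intro z hz
    refine ContinuousLinearMap.opNorm_le_bound _ (inv_nonneg.2 (by linarith)) fun y => ?_
    have hpos : 0 < |z.re| - ‖B‖ := by linarith
    have h1 := (hsol z y).norm_le (ρ := |z.re|) (by linarith [norm_nonneg B])
      (abs_re_le_norm_add hd z)
    rw [← div_eq_inv_mul, le_div_iff₀ hpos]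
    linarith
  have hshift : ∀ z (k : ℤ), ‖resolv hd B z‖ ≤ ‖resolv hd B (z + Complex.I * ω * k)‖ := by
    intro z k
    refine ContinuousLinearMap.opNorm_le_bound _ (norm_nonneg _) fun y => ?_
    have h1 := (sol_iff_resolv hd (hu _) _ _).1 (hS k z _ _ (hsol z y))
    calc ‖resolv hd B z y‖ = ‖S k (resolv hd B z y)‖ := (hSn k _).symm
      _ = ‖resolv hd B (z + Complex.I * ω * k) (S k y)‖ := by rw [h1]
      _ ≤ ‖resolv hd B (z + Complex.I * ω * k)‖ * ‖S k y‖ := ContinuousLinearMap.le_opNorm _ _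
      _ = _ := by rw [hSn k]
  let R : Set ℂ := Icc (-(‖B‖ + 1)) (‖B‖ + 1) ×ℂ Icc 0 ω
  have hR : IsCompact R := isCompact_Icc.reProdIm isCompact_Icc
  obtain ⟨C, hC⟩ := hR.exists_bound_of_continuousOn hdiff.continuous.continuousOn
  have hbd : ∀ z, ‖resolv hd B z‖ ≤ max C 1 := by
    intro z
    by_cases hz : ‖B‖ + 1 ≤ |z.re|
    · refine ((hfar z hz).trans (inv_le_one_of_one_le₀ (by linarith))).trans (le_max_right _ _)
    · refine ((hshift z (-⌊z.im / ω⌋)).trans (hC _ ?_)).trans (le_max_left _ _)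
      have hz' := abs_lt.1 (not_le.1 hz)
      have h1 := Int.floor_le (z.im / ω)
      have h2 := Int.lt_floor_add_one (z.im / ω)
      rw [le_div_iff₀ hω] at h1
      rw [div_lt_iff₀ hω] at h2
      rw [Complex.mem_reProdIm]
      constructor
      · have : (z + Complex.I * ω * ((-⌊z.im / ω⌋ : ℤ) : ℂ)).re = z.re := by simp
        rw [this]
        exact ⟨hz'.1.le, hz'.2.le⟩
      · simp only [Complex.add_im, Complex.mul_im, Complex.mul_re, Complex.I_re, Complex.I_im,
          Complex.ofReal_re, Complex.ofReal_im, Complex.intCast_im, Complex.intCast_re, mem_Icc,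
          Int.cast_neg, Complex.neg_re, Complex.neg_im]
        constructor <;> nlinarith
  have hbdd : Bornology.IsBounded (range (resolv hd B)) :=
    isBounded_iff_forall_norm_le.2 ⟨max C 1, by rintro _ ⟨z, rfl⟩; exact hbd z⟩
  have hzero : ∀ z, resolv hd B z = 0 := by
    intro z
    have h1 : Tendsto (fun t : ℝ => (t - ‖B‖)⁻¹) atTop (𝓝 0) :=
      tendsto_inv_atTop_zero.comp (tendsto_atTop_add_const_right _ _ tendsto_id)
    rw [← norm_le_zero_iff]
    refine ge_of_tendsto h1 ?_
    filter_upwards [eventually_ge_atTop (‖B‖ + 1)] with t ht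
    have h2 := hfar (t : ℂ)
    have h3 : 0 ≤ t := by linarith [norm_nonneg B]
    rw [Complex.ofReal_re, abs_of_nonneg h3] at h2
    rw [hdiff.apply_eq_apply_of_bounded hbdd z t]
    exact h2 ht
  obtain ⟨i⟩ := ‹Nonempty ι›
  have h1 := hsol 0 (lp.single 2 i (1 : ℂ)) i
  rw [hzero] at h1
  simp at h1

end StrongLimits

/-! ### From infinite matrices on their maximal domain to bounded-plus-diagonal operators. -/

section MatrixOperators

variable {ι κ : Type*}

/-- The bounded operator `B` is given by the matrix `M`. -/
def Represents (B : EllTwo ι →L[ℂ] EllTwo ι) (M : Matrix ι ι ℂ) : Prop :=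
  ∀ x i, HasSum (fun j => M i j * x j) (B x i)

/-- The row sums of `M` converge for every `x`, and `diag d` adds one term per row. Membership in
the maximal domain is then only the square-summability of `B x - d x`. -/
theorem matrixOp_sub_diagonal_iff [DecidableEq ι] {B : EllTwo ι →L[ℂ] EllTwo ι} {M : Matrix ι ι ℂ}
    (hM : Represents B M) (d : ι → ℂ) (x y : EllTwo ι) :
    (∃ h : x ∈ (matrixOp (M - Matrix.diagonal d)).domain,
      matrixOp (M - Matrix.diagonal d) ⟨x, h⟩ = y) ↔ ∀ i, B x i - d i * x i = y i := by
  have hsum : ∀ i, HasSum (fun j => (M - Matrix.diagonal d) i j * x j) (B x i - d i * x i) := by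
    intro i
    have h1 : HasSum (fun j => Matrix.diagonal d i j * x j) (d i * x i) := by
      convert! hasSum_single (f := fun j => Matrix.diagonal d i j * x j) i fun j hj => ?_ using 1
      · simp
      · simp [Matrix.diagonal_apply_ne' _ hj]
    convert! (hM x i).sub h1 using 1
    funext j
    simp [sub_mul]
  constructor
  · rintro ⟨h, rfl⟩ i
    exact (hsum i).tsum_eq.symm
  · intro h
    have e : (fun i => ∑' j, (M - Matrix.diagonal d) i j * x j) = y := by
      funext i; rw [(hsum i).tsum_eq, h]
    exact ⟨⟨fun i => (hsum i).summable, e ▸ lp.memℓp y⟩, lp.ext e⟩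

theorem matrixOp_sub_smul_iff [DecidableEq ι] {B : EllTwo ι →L[ℂ] EllTwo ι} {M : Matrix ι ι ℂ}
    (hM : Represents B M) (d : ι → ℂ) (z : ℂ) (x y : EllTwo ι) :
    (∃ h : x ∈ (matrixOp (M - Matrix.diagonal d)).domain,
      matrixOp (M - Matrix.diagonal d) ⟨x, h⟩ - z • x = y) ↔ Sol B d z x y := by
  simp only [sub_eq_iff_eq_add]
  rw [matrixOp_sub_diagonal_iff hM]
  refine forall_congr' fun i => ?_
  simp only [lp.coeFn_add, lp.coeFn_smul, Pi.add_apply, Pi.smul_apply, smul_eq_mul]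
  constructor <;> intro h <;> linear_combination h

theorem isEigenvector_matrixOp_iff [DecidableEq ι] {B : EllTwo ι →L[ℂ] EllTwo ι}
    {M : Matrix ι ι ℂ} (hM : Represents B M) (d : ι → ℂ) (z : ℂ) (x : EllTwo ι) :
    IsEigenvector (matrixOp (M - Matrix.diagonal d)) z x ↔ x ≠ 0 ∧ Sol B d z x 0 := by
  rw [IsEigenvector, ← matrixOp_sub_smul_iff hM]
  simp only [sub_eq_zero]

theorem mem_eigenvalues_matrixOp_iff [DecidableEq ι] {B : EllTwo ι →L[ℂ] EllTwo ι}
    {M : Matrix ι ι ℂ} (hM : Represents B M) (d : ι → ℂ) (z : ℂ) :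
    z ∈ eigenvalues (matrixOp (M - Matrix.diagonal d)) ↔ IsEig B d z :=
  exists_congr fun x => isEigenvector_matrixOp_iff hM d z x

/-- The resolvent is compact, so there is only point spectrum. -/
theorem mem_opSpectrum_matrixOp_iff [DecidableEq ι] {B : EllTwo ι →L[ℂ] EllTwo ι}
    {M : Matrix ι ι ℂ} (hM : Represents B M) {d : ι → ℂ} (hd : ∀ i, (d i).re = 0)
    (hd' : Tendsto (fun i => ‖d i‖) cofinite atTop) (z : ℂ) :
    z ∈ opSpectrum (matrixOp (M - Matrix.diagonal d)) ↔ IsEig B d z := by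
  constructor
  · intro hz
    by_contra hno
    have hu := isUnit_of_not_isEig hd hd' hno
    refine hz ⟨resolv hd B z, fun y => ?_, fun x => ?_⟩
    · exact (matrixOp_sub_smul_iff hM d z _ y).2 ((sol_iff_resolv hd hu _ _).2 rfl)
    · have h1 := (matrixOp_sub_smul_iff hM d z x.1 _).1 ⟨x.2, rfl⟩
      exact ((sol_iff_resolv hd hu _ _).1 h1).symm
  · rintro ⟨x, hx, hs⟩ ⟨R, -, hR⟩
    obtain ⟨h, h1⟩ := (matrixOp_sub_smul_iff hM d z x 0).2 hs
    have h2 := hR ⟨x, h⟩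
    rw [h1, map_zero] at h2
    exact hx h2.symm

theorem norm_pull_equiv (e : ι ≃ κ) (x : EllTwo κ) : ‖pull e e.injective x‖ = ‖x‖ := by
  refine le_antisymm ?_ ?_
  · simpa using EllTwo.norm_le_mul (x := x) (y := pull e e.injective x) zero_le_one e e.injective
      fun k => by simp
  · simpa using EllTwo.norm_le_mul (x := pull e e.injective x) (y := x) zero_le_one e.symm
      e.symm.injective fun k => by simp

/-- Relabelling that preserves the matrix and translates the diagonal by `c` translates `z` by `c`.
It serves both the periodicity of the full operator and the comparison of truncations at different
levels. -/
theorem Sol.reindex {B : EllTwo ι →L[ℂ] EllTwo ι} {B' : EllTwo κ →L[ℂ] EllTwo κ}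
    {M : Matrix ι ι ℂ} {M' : Matrix κ κ ℂ} (hM : Represents B M) (hM' : Represents B' M')
    {d : ι → ℂ} {d' : κ → ℂ} {c : ℂ} (e : κ ≃ ι) (he : ∀ i j, M (e i) (e j) = M' i j)
    (hd : ∀ i, d' i = d (e i) - c) {z : ℂ} {x y : EllTwo ι} (h : Sol B d z x y) :
    Sol B' d' (z + c) (pull e e.injective x) (pull e e.injective y) := by
  intro i
  have h1 : B' (pull e e.injective x) i = B x (e i) := by
    refine (hM' _ i).unique ?_
    have h2 := e.hasSum_iff.2 (hM x (e i))
    simpa only [Function.comp_def, he] using! h2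
  rw [h1, hd, pull_apply, pull_apply, ← h (e i)]
  ring

theorem IsEig.reindex {B : EllTwo ι →L[ℂ] EllTwo ι} {B' : EllTwo κ →L[ℂ] EllTwo κ}
    {M : Matrix ι ι ℂ} {M' : Matrix κ κ ℂ} (hM : Represents B M) (hM' : Represents B' M')
    {d : ι → ℂ} {d' : κ → ℂ} {c : ℂ} (e : κ ≃ ι) (he : ∀ i j, M (e i) (e j) = M' i j)
    (hd : ∀ i, d' i = d (e i) - c) {z : ℂ} (h : IsEig B d z) : IsEig B' d' (z + c) := by
  obtain ⟨x, hx, hs⟩ := h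
  refine ⟨pull e e.injective x, ?_, ?_⟩
  · rw [← norm_ne_zero_iff] at hx ⊢
    rwa [norm_pull_equiv]
  · have := hs.reindex hM hM' e he hd
    rwa [map_zero] at this

end MatrixOperators

/-! ### Compressions to a subset of indices and their extension by zero. -/

section Compression

variable {ι κ : Type*} {f : κ → ι} (hf : Function.Injective f)

/-- The compression of `B` to the indices in the range of `f`. -/
noncomputable def compress (B : EllTwo ι →L[ℂ] EllTwo ι) : EllTwo κ →L[ℂ] EllTwo κ :=
  pull f hf ∘L B ∘L push f hf

/-- The projection onto the vectors supported in the range of `f`. -/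
noncomputable def rangeProj : EllTwo ι →L[ℂ] EllTwo ι := push f hf ∘L pull f hf

theorem compress_represents {B : EllTwo ι →L[ℂ] EllTwo ι} {M : Matrix ι ι ℂ}
    (hM : Represents B M) : Represents (compress hf B) (M.submatrix f f) := by
  classical
  intro x p
  have h1 := hM (push f hf x) (f p)
  rw [← hf.hasSum_iff] at h1
  · convert! h1 using 1
    funext q
    simp [push_apply]
  · intro i hi
    rw [push_apply_of_notMem f hf x hi, mul_zero]

theorem rangeProj_apply_self (x : EllTwo ι) (k : κ) : rangeProj hf x (f k) = x (f k) := by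
  classical exact push_apply f hf _ k

theorem rangeProj_apply_of_notMem (x : EllTwo ι) {i : ι} (hi : i ∉ range f) :
    rangeProj hf x i = 0 := by
  classical exact push_apply_of_notMem f hf _ hi

theorem pull_push (x : EllTwo κ) : pull f hf (push f hf x) = x := by
  classical
  ext k
  exact push_apply f hf _ k

theorem norm_rangeProj_le : ‖rangeProj hf‖ ≤ 1 := by
  refine ContinuousLinearMap.opNorm_le_bound _ zero_le_one fun x => ?_
  refine EllTwo.norm_le_mul zero_le_one id Function.injective_id fun i => ?_
  by_cases hi : i ∈ range f
  · obtain ⟨k, rfl⟩ := hi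
    rw [rangeProj_apply_self, one_mul, id]
  · rw [rangeProj_apply_of_notMem hf x hi, norm_zero]
    positivity

theorem norm_rangeProj_mul_mul_le (B : EllTwo ι →L[ℂ] EllTwo ι) :
    ‖rangeProj hf * B * rangeProj hf‖ ≤ ‖B‖ := by
  have h := norm_rangeProj_le hf
  calc ‖rangeProj hf * B * rangeProj hf‖ ≤ ‖rangeProj hf‖ * ‖B‖ * ‖rangeProj hf‖ :=
        (norm_mul_le _ _).trans (mul_le_mul_of_nonneg_right (norm_mul_le _ _) (norm_nonneg _))
    _ ≤ 1 * ‖B‖ * 1 := by gcongr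
    _ = ‖B‖ := by ring

theorem isEig_rangeProj_of_compress {B : EllTwo ι →L[ℂ] EllTwo ι} {d : ι → ℂ} {z : ℂ}
    (h : IsEig (compress hf B) (d ∘ f) z) : IsEig (rangeProj hf * B * rangeProj hf) d z := by
  classical
  obtain ⟨x, hx, hs⟩ := h
  refine ⟨push f hf x, fun h0 => hx ?_, fun i => ?_⟩
  · rw [← pull_push hf x, h0, map_zero]
  · change rangeProj hf (B (push f hf (pull f hf (push f hf x)))) i - _ = _
    rw [pull_push]
    by_cases hi : i ∈ range f
    · obtain ⟨k, rfl⟩ := hi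
      rw [rangeProj_apply_self, push_apply]
      exact hs k
    · rw [rangeProj_apply_of_notMem hf _ hi, push_apply_of_notMem f hf x hi]
      simp

/-- Extension by zero leaves the bare diagonal on the deleted indices and so creates the extra
eigenvalues `-d i` there. The hypothesis on `z` excludes them. -/
theorem isEig_compress_of_rangeProj {B : EllTwo ι →L[ℂ] EllTwo ι} {d : ι → ℂ} {z : ℂ}
    (h : IsEig (rangeProj hf * B * rangeProj hf) d z) (hz : ∀ i, i ∉ range f → d i + z ≠ 0) :
    IsEig (compress hf B) (d ∘ f) z := by
  obtain ⟨x, hx, hs⟩ := h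
  have h0 : ∀ i, i ∉ range f → x i = 0 := fun i hi => by
    have h1 := hs i
    change rangeProj hf (B (rangeProj hf x)) i - _ = _ at h1
    rw [rangeProj_apply_of_notMem hf _ hi] at h1
    simpa [hz i hi] using h1
  refine ⟨pull f hf x, fun h => hx ?_, fun k => ?_⟩
  · ext i
    by_cases hi : i ∈ range f
    · obtain ⟨k, rfl⟩ := hi
      exact congrArg (fun u : EllTwo κ => u k) h
    · exact h0 i hi
  · have h1 := hs (f k)
    change rangeProj hf (B (rangeProj hf x)) (f k) - _ = _ at h1
    rwa [rangeProj_apply_self] at h1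

/-- Truncating an exact eigenvector leaves a residual that only involves its tail. -/
theorem Sol.compress {B : EllTwo ι →L[ℂ] EllTwo ι} {d : ι → ℂ} {z : ℂ} {V : EllTwo ι}
    (h : Sol B d z V 0) : Sol (compress hf B) (d ∘ f) z (pull f hf V)
      (pull f hf (B (rangeProj hf V - V))) := fun k => by
  have h1 := h (f k)
  rw [map_sub]
  change B (rangeProj hf V) (f k) - _ = B (rangeProj hf V) (f k) - B V (f k)
  simp only [lp.coeFn_zero, Pi.zero_apply] at h1
  simp only [Function.comp_apply, pull_apply]
  linear_combination h1

/-- The eigenvalue equation reads `(d i + z) V i = (B V) i`, and it is divided by a factor of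
modulus at least `ρ` on the deleted indices. -/
theorem Sol.norm_tail_le {B : EllTwo ι →L[ℂ] EllTwo ι} {d : ι → ℂ} {z : ℂ} {V : EllTwo ι}
    (h : Sol B d z V 0) {ρ : ℝ} (hρ : 0 < ρ) (hi : ∀ i, i ∉ range f → ρ ≤ ‖d i + z‖) :
    ρ * ‖rangeProj hf V - V‖ ≤ ‖B‖ * ‖V‖ := by
  have h1 : ‖rangeProj hf V - V‖ ≤ ρ⁻¹ * ‖B V‖ := by
    refine EllTwo.norm_le_mul (inv_nonneg.2 hρ.le) id Function.injective_id fun i => ?_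
    by_cases hir : i ∈ range f
    · obtain ⟨k, rfl⟩ := hir
      rw [lp.coeFn_sub, Pi.sub_apply, rangeProj_apply_self, sub_self, norm_zero]
      positivity
    · rw [← div_eq_inv_mul, le_div_iff₀ hρ, lp.coeFn_sub, Pi.sub_apply,
        rangeProj_apply_of_notMem hf _ hir, zero_sub, norm_neg, id]
      have h2 : B V i = (d i + z) * V i := by
        have := h i
        simp only [lp.coeFn_zero, Pi.zero_apply] at this
        linear_combination this
      rw [h2, norm_mul, mul_comm]
      exact mul_le_mul_of_nonneg_right (hi i hir) (norm_nonneg _)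
  rw [← div_eq_inv_mul, le_div_iff₀ hρ] at h1
  calc ρ * ‖rangeProj hf V - V‖ ≤ ‖B V‖ := by rwa [mul_comm]
    _ ≤ _ := B.le_opNorm V

theorem norm_pull_le (x : EllTwo ι) : ‖pull f hf x‖ ≤ ‖x‖ := by
  simpa using EllTwo.norm_le_mul (x := x) (y := pull f hf x) zero_le_one f hf fun k => by simp

theorem norm_rangeProj_apply_le_pull (x : EllTwo ι) : ‖rangeProj hf x‖ ≤ ‖pull f hf x‖ := by
  have h1 : ‖push f hf‖ ≤ 1 := by
    rw [push, LinearIsometryEquiv.norm_map]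
    exact ContinuousLinearMap.opNorm_le_bound _ zero_le_one fun x => by
      rw [one_mul]; exact norm_pull_le hf x
  exact ((push f hf).le_opNorm _).trans (mul_le_of_le_one_left (norm_nonneg _) h1)

end Compression

/-! ### Strong convergence of exhausting compressions. -/

section ExhaustingCompressions

variable {ι : Type*} {κ : ℕ → Type*} {f : ∀ m, κ m → ι} (hf : ∀ m, Function.Injective (f m))
  (hex : ∀ i, ∀ᶠ m in atTop, i ∈ range (f m))

include hex in
theorem tendsto_rangeProj (x : EllTwo ι) :
    Tendsto (fun m => rangeProj (hf m) x) atTop (𝓝 x) := by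
  classical
  rw [Metric.tendsto_nhds]
  intro ε hε
  have h1 := lp.hasSum_single (p := 2) (by norm_num) x
  obtain ⟨s, hs⟩ := (h1.eventually (Metric.ball_mem_nhds x hε)).exists
  have h2 : ∀ᶠ m in atTop, ∀ i ∈ s, i ∈ range (f m) :=
    (Finset.eventually_all s).2 fun i _ => hex i
  filter_upwards [h2] with m hm
  refine lt_of_le_of_lt ?_ hs
  rw [dist_eq_norm, dist_eq_norm]
  have h3 := EllTwo.norm_le_mul (x := (∑ i ∈ s, lp.single 2 i (x i)) - x)
    (y := rangeProj (hf m) x - x) zero_le_one id Function.injective_id fun i => ?_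
  · rwa [one_mul] at h3
  · rw [one_mul, id]
    by_cases hi : i ∈ range (f m)
    · obtain ⟨k, rfl⟩ := hi
      rw [lp.coeFn_sub, Pi.sub_apply, rangeProj_apply_self, sub_self, norm_zero]
      positivity
    · have hi' : i ∉ s := fun h => hi (hm i h)
      rw [lp.coeFn_sub, Pi.sub_apply, rangeProj_apply_of_notMem _ _ hi, lp.coeFn_sub, Pi.sub_apply,
        lp.coeFn_sum, Finset.sum_apply]
      rw [Finset.sum_eq_zero fun j hj => ?_]
      exact lp.single_apply_ne 2 j _ (fun h => hi' (h ▸ hj))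

include hex in
theorem tendsto_rangeProj_mul_mul (B : EllTwo ι →L[ℂ] EllTwo ι) (x : EllTwo ι) :
    Tendsto (fun m => (rangeProj (hf m) * B * rangeProj (hf m)) x) atTop (𝓝 (B x)) := by
  have h1 := tendsto_rangeProj hf hex (B x)
  have h2 : Tendsto (fun m => rangeProj (hf m) (B (rangeProj (hf m) x - x))) atTop (𝓝 0) := by
    have h3 : Tendsto (fun m => ‖B (rangeProj (hf m) x - x)‖) atTop (𝓝 0) := by
      have h4 : Tendsto (fun m => rangeProj (hf m) x - x) atTop (𝓝 0) := by
        simpa using (tendsto_rangeProj hf hex x).sub_const x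
      simpa using ((B.continuous.tendsto 0).comp h4).norm
    refine squeeze_zero_norm (fun m => ?_) h3
    exact ((rangeProj (hf m)).le_opNorm _).trans
      (mul_le_of_le_one_left (norm_nonneg _) (norm_rangeProj_le _))
  have h5 := h2.add h1
  rw [zero_add] at h5
  refine h5.congr fun m => ?_
  rw [← map_add, ← map_add, sub_add_cancel]
  rfl

end ExhaustingCompressions

/-! ### Multiplication by a bounded periodic function as a Laurent operator. -/

section Laurent

theorem fourier_coe_eq_exp {T : ℝ} (k : ℤ) (x : ℝ) :
    fourier k (x : AddCircle T) = Complex.exp (Complex.I * (omega T : ℂ) * (k : ℂ) * (x : ℂ)) := by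
  rw [fourier_coe_apply, omega]
  congr 1
  push_cast
  ring

variable {T : ℝ} [hT : Fact (0 < T)]

/-- A bounded signal on a period, as a function on the circle. -/
noncomputable def liftLp (a : ℝ → ℂ) (ha : MemLp a ⊤ (volume.restrict (Ioc 0 T))) :
    Lp ℂ ⊤ (@haarAddCircle T hT) :=
  (MemLp.memLp_liftIoc (t := 0) (f := a) (by rwa [zero_add])).haarAddCircle.toLp

theorem coeFn_liftLp (a : ℝ → ℂ) (ha : MemLp a ⊤ (volume.restrict (Ioc 0 T))) :
    liftLp a ha =ᵐ[haarAddCircle] liftIoc T 0 a := MemLp.coeFn_toLp _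

/-- Multiplication by a bounded function on the circle. -/
noncomputable def mulOp (a : Lp ℂ ⊤ (@haarAddCircle T hT)) :
    Lp ℂ 2 (@haarAddCircle T hT) →L[ℂ] Lp ℂ 2 (@haarAddCircle T hT) :=
  (ContinuousLinearMap.mul ℂ ℂ).holderL haarAddCircle ⊤ 2 2 a

theorem coeFn_mulOp (a : Lp ℂ ⊤ (@haarAddCircle T hT)) (h : Lp ℂ 2 (@haarAddCircle T hT)) :
    mulOp a h =ᵐ[haarAddCircle] fun x => a x * h x :=
  (ContinuousLinearMap.mul ℂ ℂ).coeFn_holder a h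

theorem repr_mulOp_liftLp (a : ℝ → ℂ) (ha : MemLp a ⊤ (volume.restrict (Ioc 0 T)))
    {h : Lp ℂ 2 (@haarAddCircle T hT)} {g : AddCircle T → ℂ} (hg : h =ᵐ[haarAddCircle] g) (k : ℤ) :
    fourierBasis.repr (mulOp (liftLp a ha) h) k =
      fourierCoeff (fun x => liftIoc T 0 a x * g x) k := by
  rw [fourierBasis_repr]
  refine congrFun (fourierCoeff_congr_ae ?_) k
  filter_upwards [coeFn_mulOp (liftLp a ha) h, coeFn_liftLp a ha, hg] with x h1 h2 h3
  rw [h1, h2, h3]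

theorem fourierCoeff_liftIoc_eq_phasor (a : ℝ → ℂ) (k : ℤ) :
    fourierCoeff (liftIoc T 0 a) k = phasor T a k := by
  rw [fourierCoeff_eq_intervalIntegral _ _ 0, phasor, zero_add]
  rw [intervalIntegral.integral_of_le hT.out.le, intervalIntegral.integral_of_le hT.out.le]
  rw [← Complex.ofReal_one, ← Complex.ofReal_div, Complex.real_smul]
  congr 1
  refine setIntegral_congr_fun measurableSet_Ioc fun x hx => ?_
  simp only [smul_eq_mul]
  rw [liftIoc_zero_coe_apply hx, fourier_coe_eq_exp, mul_comm]
  push_cast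
  congr 2
  ring

/-- The Laurent operator with symbol `a`, on the Fourier side. -/
noncomputable def laurent (a : Lp ℂ ⊤ (@haarAddCircle T hT)) : EllTwo ℤ →L[ℂ] EllTwo ℤ :=
  (fourierBasis.repr : Lp ℂ 2 (@haarAddCircle T hT) ≃ₗᵢ[ℂ] EllTwo ℤ).toContinuousLinearEquiv ∘L
    mulOp a ∘L
    (fourierBasis.repr : Lp ℂ 2 (@haarAddCircle T hT) ≃ₗᵢ[ℂ] EllTwo ℤ).symm.toContinuousLinearEquiv

theorem laurent_apply (a : Lp ℂ ⊤ (@haarAddCircle T hT)) (x : EllTwo ℤ) :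
    laurent a x = fourierBasis.repr (mulOp a (fourierBasis.repr.symm x)) := rfl

theorem hasSum_fourierLp (x : EllTwo ℤ) :
    HasSum (fun l => x l • @fourierLp T hT 2 _ l) (fourierBasis.repr.symm x) := by
  have h := (@fourierBasis T hT).hasSum_repr_symm x
  simpa only [coe_fourierBasis] using h

/-- Continuity allows the Fourier series of the vector to be multiplied by the symbol term by term;
the `k`-th coefficient of `a` times the `l`-th exponential is the phasor of index `k - l`. -/
theorem laurent_represents (a : ℝ → ℂ) (ha : MemLp a ⊤ (volume.restrict (Ioc 0 T))) :
    Represents (laurent (T := T) (liftLp a ha)) (Matrix.of fun k l => phasor T a (k - l)) := by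
  intro x k
  have h1 := (mulOp (liftLp a ha)).hasSum (hasSum_fourierLp (T := T) x)
  have h2 := (fourierBasis.repr : Lp ℂ 2 (@haarAddCircle T hT) ≃ₗᵢ[ℂ] EllTwo ℤ)
    |>.toContinuousLinearEquiv.toContinuousLinearMap.hasSum h1
  have h3 := (lp.evalCLM ℂ (fun _ : ℤ => ℂ) 2 k).hasSum h2
  rw [laurent_apply]
  convert! h3 using 1
  funext l
  simp only [map_smul, Matrix.of_apply, smul_eq_mul]
  rw [mul_comm]
  congr 1
  change phasor T a (k - l) = fourierBasis.repr (mulOp (liftLp a ha) (fourierLp 2 l)) k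
  rw [repr_mulOp_liftLp a ha (coeFn_fourierLp 2 l), ← fourierCoeff_liftIoc_eq_phasor]
  refine integral_congr_ae (ae_of_all _ fun x => ?_)
  simp only [smul_eq_mul]
  rw [neg_sub, sub_eq_add_neg, add_comm, fourier_add]
  ring

end Laurent

/-! ### The block Toeplitz matrix as a bounded operator. -/

section Toeplitz

variable {n : ℕ} {T : ℝ} [hT : Fact (0 < T)]

theorem block_injective (i : Fin n) : Function.Injective fun k : ℤ => (i, k) :=
  fun _ _ h => (Prod.mk.inj h).2

/-- The `i`-th block of a vector. -/
noncomputable def block (i : Fin n) : EllTwo (Fin n × ℤ) →L[ℂ] EllTwo ℤ :=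
  pull (fun k => (i, k)) (block_injective i)

@[simp] theorem block_apply (i : Fin n) (x : EllTwo (Fin n × ℤ)) (k : ℤ) :
    block i x k = x (i, k) := rfl

/-- The bounded operator on `ℓ²` given by the block Toeplitz matrix. -/
noncomputable def toeplitzOp (A : ℝ → Matrix (Fin n) (Fin n) ℂ) (hA : EssBounded T A) :
    EllTwo (Fin n × ℤ) →L[ℂ] EllTwo (Fin n × ℤ) :=
  ∑ i, ∑ j, push (fun k => (i, k)) (block_injective i) ∘L
    laurent (liftLp (fun t => A t i j) (hA i j)) ∘L block j

theorem toeplitzOp_apply (A : ℝ → Matrix (Fin n) (Fin n) ℂ) (hA : EssBounded T A)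
    (x : EllTwo (Fin n × ℤ)) (i : Fin n) (k : ℤ) :
    toeplitzOp A hA x (i, k) =
      ∑ j, laurent (liftLp (fun t => A t i j) (hA i j)) (block j x) k := by
  simp only [toeplitzOp, sum_apply, lp.coeFn_sum, Finset.sum_apply,
    ContinuousLinearMap.comp_apply]
  rw [Finset.sum_eq_single i]
  · exact Finset.sum_congr rfl fun j _ =>
      push_apply (fun k => (i, k)) (block_injective i) _ k
  · intro i' _ hi
    refine Finset.sum_eq_zero fun j _ => ?_
    refine push_apply_of_notMem (fun k => (i', k)) (block_injective i') _ ?_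
    rintro ⟨l, hl⟩
    exact hi (Prod.mk.inj hl).1
  · intro h
    exact absurd (Finset.mem_univ i) h

theorem toeplitzOp_represents (A : ℝ → Matrix (Fin n) (Fin n) ℂ) (hA : EssBounded T A) :
    Represents (toeplitzOp A hA) (toeplitz T A) := by
  rintro x ⟨i, k⟩
  rw [toeplitzOp_apply]
  have h1 : ∀ j, HasSum (fun q : Fin n × ℤ => if q.1 = j then toeplitz T A (i, k) q * x q else 0)
      (laurent (liftLp (fun t => A t i j) (hA i j)) (block j x) k) := by
    intro j
    rw [← (block_injective j).hasSum_iff]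
    · have := laurent_represents (fun t => A t i j) (hA i j) (block j x) k
      simpa [Function.comp_def, toeplitz] using this
    · rintro ⟨j', l⟩ hl
      refine if_neg fun h => hl ⟨l, by rw [← h]⟩
  have h2 := hasSum_sum fun j (_ : j ∈ Finset.univ) => h1 j
  simpa using h2

end Toeplitz

/-! ### The diagonal of frequencies. -/

section Frequencies

variable (n : ℕ) (T : ℝ)

/-- The diagonal of `𝒩`. -/
noncomputable def freq (p : Fin n × ℤ) : ℂ := Complex.I * (omega T : ℂ) * (p.2 : ℂ)

theorem freq_re (p : Fin n × ℤ) : (freq n T p).re = 0 := by simp [freq]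

variable {T}

theorem omega_pos (hT : 0 < T) : 0 < omega T := by unfold omega; positivity

theorem norm_freq (hT : 0 < T) (p : Fin n × ℤ) : ‖freq n T p‖ = omega T * |(p.2 : ℝ)| := by
  simp [freq, abs_of_pos (omega_pos hT)]

theorem tendsto_norm_freq (hT : 0 < T) :
    Tendsto (fun p => ‖freq n T p‖) cofinite atTop := by
  have hω := omega_pos hT
  rw [tendsto_atTop]
  intro b
  rw [Filter.eventually_cofinite]
  refine (Set.finite_univ.prod (Set.finite_Icc (-⌈b / omega T⌉) ⌈b / omega T⌉)).subset ?_
  rintro ⟨i, k⟩ hk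
  have hk : ¬ b ≤ ‖freq n T (i, k)‖ := hk
  rw [norm_freq n hT, not_le, mul_comm, ← lt_div_iff₀ hω] at hk
  have h1 : |(k : ℝ)| ≤ (⌈b / omega T⌉ : ℝ) := hk.le.trans (Int.le_ceil _)
  refine ⟨Set.mem_univ _, abs_le.1 ?_⟩
  exact_mod_cast h1

end Frequencies

/-! ### Eigenvectors as Floquet solutions of the differential equation. -/

section Floquet

variable {n : ℕ} {T : ℝ}

/-- An eigenvector of the harmonic state operator is summable in each block. -/
theorem Sol.summable_block (hT : 0 < T) {B : EllTwo (Fin n × ℤ) →L[ℂ] EllTwo (Fin n × ℤ)} {z : ℂ}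
    {V y : EllTwo (Fin n × ℤ)} (h : Sol B (freq n T) z V y) (i : Fin n) :
    Summable fun k : ℤ => V (i, k) := by
  have hω := omega_pos hT
  have h1 := (sol_iff_invDiag (freq_re n T) B z V y).1 h
  rw [eq_invDiag_iff] at h1
  -- Here `V = (diag d + 1)⁻¹ w`. Along a block both `(d + 1)⁻¹` and `w` are square-summable in `k`,
  -- so Hölder's inequality with exponents `2, 2` gives summability.
  set w := B V + (1 - z) • V - y
  have hw : Summable fun k : ℤ => ‖w (i, k)‖ ^ (2 : ℝ) := by
    have := ((memℓp_gen_iff two_toReal_pos).1 (lp.memℓp w)).comp_injective (block_injective i)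
    simpa [Function.comp_def] using this
  have hc : Summable fun k : ℤ => ‖(freq n T (i, k) + 1)⁻¹‖ ^ (2 : ℝ) := by
    have h2 : Summable fun k : ℤ => (omega T ^ 2)⁻¹ * ((1 : ℝ) / (k : ℝ) ^ 2) :=
      ((Real.summable_one_div_int_pow (p := 2)).2 (by norm_num)).mul_left _
    refine Summable.of_norm_bounded_eventually h2 ?_
    have h3 : ∀ᶠ k : ℤ in cofinite, k ≠ 0 := (Set.finite_singleton (0 : ℤ)).eventually_cofinite_notMem
    filter_upwards [h3] with k hk
    have h4 : omega T * |(k : ℝ)| ≤ ‖freq n T (i, k) + 1‖ := by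
      have := Complex.abs_im_le_norm (freq n T (i, k) + 1)
      simpa [freq, abs_mul, abs_of_pos hω] using this
    have h5 : 0 < omega T * |(k : ℝ)| := by positivity
    rw [Real.rpow_two, norm_inv, norm_pow, norm_inv, norm_norm]
    calc (‖freq n T (i, k) + 1‖⁻¹) ^ 2 ≤ ((omega T * |(k : ℝ)|)⁻¹) ^ 2 := by gcongr
      _ = _ := by rw [inv_pow, mul_pow, sq_abs, mul_inv, one_div]
  refine Summable.of_norm ?_
  have hpq : (2 : ℝ).HolderConjugate 2 := Real.HolderConjugate.two_two
  have h6 := Real.summable_mul_of_Lp_Lq_of_nonneg hpq (fun _ => norm_nonneg _) (fun _ => norm_nonneg _) hc hw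
  refine h6.congr fun k => ?_
  have h7 : freq n T (i, k) + 1 ≠ 0 := fun h => by
    have := one_le_norm_add_one (freq_re n T) (i, k)
    rw [h, norm_zero] at this; linarith
  rw [← norm_mul, ← h1 (i, k), inv_mul_cancel_left₀ h7]

/-- The signal with given Fourier coefficients in block `i`. -/
noncomputable def signal (T : ℝ) (V : EllTwo (Fin n × ℤ)) (i : Fin n) : C(AddCircle T, ℂ) :=
  ∑' k : ℤ, V (i, k) • fourier k

theorem hasSum_signal [hT : Fact (0 < T)] {V : EllTwo (Fin n × ℤ)} {i : Fin n}
    (h : Summable fun k : ℤ => V (i, k)) :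
    HasSum (fun k : ℤ => V (i, k) • @fourier T k) (signal T V i) := by
  refine Summable.hasSum (Summable.of_norm ?_)
  simpa only [norm_smul, fourier_norm, mul_one] using h.norm

theorem hasSum_signal_apply [hT : Fact (0 < T)] {V : EllTwo (Fin n × ℤ)} {i : Fin n}
    (h : Summable fun k : ℤ => V (i, k)) (t : ℝ) :
    HasSum (fun k : ℤ => V (i, k) * Complex.exp (freq n T (i, k) * t)) (signal T V i t) := by
  have h1 := (ContinuousMap.evalCLM ℂ (t : AddCircle T)).hasSum (hasSum_signal h)
  convert! h1 using 1
  funext k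
  simp only [map_smul, smul_eq_mul, freq, ← fourier_coe_eq_exp]
  rfl

theorem coeFn_repr_symm_block [hT : Fact (0 < T)] {V : EllTwo (Fin n × ℤ)} {i : Fin n}
    (h : Summable fun k : ℤ => V (i, k)) :
    (fourierBasis.repr.symm (block i V) : Lp ℂ 2 (@haarAddCircle T hT))
      =ᵐ[haarAddCircle] signal T V i := by
  have h1 := (ContinuousMap.toLp (E := ℂ) 2 (@haarAddCircle T hT) ℂ).hasSum (hasSum_signal h)
  have h2 : HasSum (fun k : ℤ => V (i, k) • @fourierLp T hT 2 _ k)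
      (ContinuousMap.toLp (E := ℂ) 2 (@haarAddCircle T hT) ℂ (signal T V i)) := by
    convert! h1 using 1
  rw [(hasSum_fourierLp (block i V)).unique h2]
  exact ContinuousMap.coeFn_toLp _ _

/-- The integral form of the differential equation satisfied by an eigenvector. -/
theorem Sol.signal_integral [hT : Fact (0 < T)] {A : ℝ → Matrix (Fin n) (Fin n) ℂ}
    (hA : EssBounded T A) {z : ℂ} {V : EllTwo (Fin n × ℤ)}
    (h : Sol (toeplitzOp A hA) (freq n T) z V 0) (i : Fin n) {t : ℝ} (ht : t ∈ Icc 0 T) :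
    Complex.exp (z * t) * signal T V i (t : ℝ) - signal T V i (0 : ℝ) =
      ∫ s in (0 : ℝ)..t, ∑ j, A s i j * (Complex.exp (z * s) * signal T V j (s : ℝ)) := by
  have hsum := fun j => h.summable_block hT.out j
  let X : Fin n → Lp ℂ 2 (@haarAddCircle T hT) := fun j => fourierBasis.repr.symm (block j V)
  let g : Lp ℂ 2 (@haarAddCircle T hT) := ∑ j, mulOp (liftLp (fun t => A t i j) (hA i j)) (X j)
  have hg : g =ᵐ[haarAddCircle] fun x => ∑ j, liftIoc T 0 (fun t => A t i j) x * signal T V j x := by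
    have h1 : ∀ j, (mulOp (liftLp (fun t => A t i j) (hA i j)) (X j)) =ᵐ[haarAddCircle]
        fun x => liftIoc T 0 (fun t => A t i j) x * signal T V j x := by
      intro j
      filter_upwards [coeFn_mulOp (liftLp (fun t => A t i j) (hA i j)) (X j),
        coeFn_liftLp (fun t => A t i j) (hA i j), coeFn_repr_symm_block (hsum j)] with x h1 h2 h3
      rw [h1, h2, h3]
    have h2 := Lp.coeFn_finsetSum (p := 2) (μ := @haarAddCircle T hT) Finset.univ
      fun j => mulOp (liftLp (fun t => A t i j) (hA i j)) (X j)
    filter_upwards [h2, ae_all_iff.2 h1] with x h3 h4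
    rw [h3, Finset.sum_apply]
    exact Finset.sum_congr rfl fun j _ => h4 j
  have hcoef : ∀ k, fourierBasis.repr g k = (freq n T (i, k) + z) * V (i, k) := by
    intro k
    have h1 := h (i, k)
    rw [toeplitzOp_apply] at h1
    simp only [lp.coeFn_zero, Pi.zero_apply, sub_eq_zero] at h1
    rw [← h1]
    simp only [g, map_sum, lp.coeFn_sum, Finset.sum_apply]
    rfl
  -- Integration over `[0, t]` against `exp (z s)` becomes the zeroth Fourier coefficient of a
  -- product with the bounded function `e`, hence a continuous functional on `L²`. Applied termwise
  -- to the Fourier series of `g`, it yields the integral equation without differentiating the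
  -- signal.
  let e : ℝ → ℂ := (Iic t).indicator fun s => Complex.exp (z * s)
  have he : MemLp e ⊤ (volume.restrict (Ioc 0 T)) := by
    have hc : Continuous fun s : ℝ => Complex.exp (z * s) := by fun_prop
    obtain ⟨C, hC⟩ := (isCompact_Icc (a := (0 : ℝ)) (b := T)).exists_bound_of_continuousOn
      hc.continuousOn
    refine memLp_top_of_bound (hc.aestronglyMeasurable.indicator measurableSet_Iic) C ?_
    refine (ae_restrict_iff' measurableSet_Ioc).2 (ae_of_all _ fun s hs => ?_)
    exact (norm_indicator_le_norm_self _ _).trans (hC s (Ioc_subset_Icc_self hs))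
  have hphi : ∀ (f : Lp ℂ 2 (@haarAddCircle T hT)) (u : AddCircle T → ℂ),
      f =ᵐ[haarAddCircle] u → fourierBasis.repr (mulOp (liftLp e he) f) 0 =
        (1 / T) • ∫ s in (0 : ℝ)..t, Complex.exp (z * s) * u s := by
    intro f u hu
    rw [repr_mulOp_liftLp e he hu, fourierCoeff_eq_intervalIntegral _ _ 0, zero_add]
    congr 1
    have h1 : ∀ s ∈ Ioc (0 : ℝ) T, (fourier (-0) (s : AddCircle T) • (liftIoc T 0 e s * u s) : ℂ) =
        (Iic t).indicator (fun s : ℝ => Complex.exp (z * s) * u s) s := by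
      intro s hs
      rw [liftIoc_zero_coe_apply hs, neg_zero, fourier_zero, one_smul]
      simp only [e, indicator]
      split_ifs <;> simp
    rw [intervalIntegral.integral_of_le hT.out.le, setIntegral_congr_fun measurableSet_Ioc h1,
      intervalIntegral.integral_of_le ht.1, setIntegral_indicator measurableSet_Iic]
    congr 2
    ext s
    simp only [mem_inter_iff, mem_Ioc, mem_Iic]
    constructor
    · exact fun h => ⟨h.1.1, h.2⟩
    · exact fun h => ⟨⟨h.1, h.2.trans ht.2⟩, h.2⟩
  -- Keeping the factor `freq + z` on the left covers the case where it vanishes.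
  have hexp : ∀ k : ℤ, (freq n T (i, k) + z) *
      ∫ s in (0 : ℝ)..t, Complex.exp (z * s) * fourier k (s : AddCircle T) =
        Complex.exp (z * t) * Complex.exp (freq n T (i, k) * t) - 1 := by
    intro k
    have h1 : ∀ s : ℝ, (freq n T (i, k) + z) * (Complex.exp (z * s) * fourier k (s : AddCircle T)) =
        Complex.exp ((freq n T (i, k) + z) * s) * (freq n T (i, k) + z) := by
      intro s
      rw [fourier_coe_eq_exp, ← Complex.exp_add, mul_comm, freq]
      congr 2
      ring
    rw [← intervalIntegral.integral_const_mul]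
    simp only [h1]
    rw [intervalIntegral.integral_eq_sub_of_hasDerivAt
      (f := fun s : ℝ => Complex.exp ((freq n T (i, k) + z) * s))]
    · rw [← Complex.exp_add]
      simp only [Complex.ofReal_zero, mul_zero, Complex.exp_zero]
      congr 2
      ring
    · intro s _
      have := ((hasDerivAt_id (s : ℂ)).const_mul (freq n T (i, k) + z)).cexp.comp_ofReal
      simpa using this
    · exact Continuous.intervalIntegrable (by fun_prop) _ _
  have hL : HasSum (fun k : ℤ => ((freq n T (i, k) + z) * V (i, k)) *
      fourierBasis.repr (mulOp (liftLp e he) (@fourierLp T hT 2 _ k)) 0)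
      (fourierBasis.repr (mulOp (liftLp e he) g) 0) := by
    have h1 := hasSum_fourierLp (T := T) (fourierBasis.repr g)
    rw [LinearIsometryEquiv.symm_apply_apply] at h1
    have h2 := (mulOp (liftLp e he)).hasSum h1
    have h3 := (fourierBasis.repr : Lp ℂ 2 (@haarAddCircle T hT) ≃ₗᵢ[ℂ] EllTwo ℤ)
      |>.toContinuousLinearEquiv.toContinuousLinearMap.hasSum h2
    have h4 := (lp.evalCLM ℂ (fun _ : ℤ => ℂ) 2 0).hasSum h3
    convert! h4 using 1
    funext k
    simp only [map_smul, hcoef, smul_eq_mul]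
    rfl
  have hR : HasSum (fun k : ℤ => (1 / T : ℂ) * (Complex.exp (z * t) *
      (V (i, k) * Complex.exp (freq n T (i, k) * t)) -
        V (i, k) * Complex.exp (freq n T (i, k) * (0 : ℝ))))
      ((1 / T : ℂ) * (Complex.exp (z * t) * signal T V i (t : ℝ) - signal T V i (0 : ℝ))) :=
    (((hasSum_signal_apply (hsum i) t).mul_left _).sub (hasSum_signal_apply (hsum i) 0)).mul_left _
  have hLR := hL.unique (hR.congr_fun fun k => ?_)
  · rw [hphi g _ hg] at hLR
    rw [← Complex.ofReal_one, ← Complex.ofReal_div, Complex.real_smul] at hLR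
    have h0 : ((1 / T : ℝ) : ℂ) ≠ 0 := by
      rw [Complex.ofReal_ne_zero]; exact one_div_ne_zero hT.out.ne'
    rw [← mul_left_cancel₀ h0 hLR]
    rw [intervalIntegral.integral_of_le ht.1, intervalIntegral.integral_of_le ht.1]
    refine setIntegral_congr_fun measurableSet_Ioc fun s hs => ?_
    simp only [Finset.mul_sum]
    refine Finset.sum_congr rfl fun j _ => ?_
    rw [liftIoc_zero_coe_apply ⟨hs.1, hs.2.trans ht.2⟩]
    ring
  · rw [hphi _ _ (coeFn_fourierLp 2 k)]
    have h1 := hexp k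
    rw [Complex.real_smul]
    push_cast
    simp only [mul_zero, Complex.exp_zero]
    linear_combination ((1 / T : ℂ) * V (i, k)) * h1

end Floquet

/-! ### Uniqueness for the linear integral equation. -/

section Uniqueness

variable {n : ℕ} {T : ℝ}

theorem EssBounded.exists_ae_norm_le {A : ℝ → Matrix (Fin n) (Fin n) ℂ} (hA : EssBounded T A) :
    ∃ C : ℝ, 0 ≤ C ∧ ∀ᵐ s ∂(volume.restrict (Ioc 0 T)), ∀ i j, ‖A s i j‖ ≤ C := by
  let c : Fin n → Fin n → ℝ := fun i j =>
    (eLpNormEssSup (fun t => A t i j) (volume.restrict (Ioc 0 T))).toReal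
  have hc : ∀ i j, 0 ≤ c i j := fun i j => ENNReal.toReal_nonneg
  refine ⟨∑ i, ∑ j, c i j, Finset.sum_nonneg fun i _ => Finset.sum_nonneg fun j _ => hc i j, ?_⟩
  rw [ae_all_iff]; intro i
  rw [ae_all_iff]; intro j
  have h1 := (hA i j).2
  rw [eLpNorm_exponent_top] at h1
  filter_upwards [ae_le_eLpNormEssSup (f := fun t => A t i j)
    (μ := volume.restrict (Ioc 0 T))] with s hs
  have h2 : ‖A s i j‖ ≤ c i j := by
    have := ENNReal.toReal_mono h1.ne hs
    simpa using this
  refine h2.trans ((Finset.single_le_sum (fun j _ => hc i j) (Finset.mem_univ j)).trans ?_)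
  exact Finset.single_le_sum (f := fun i => ∑ j, c i j)
    (fun i _ => Finset.sum_nonneg fun j _ => hc i j) (Finset.mem_univ i)

theorem EssBounded.intervalIntegrable_mul {A : ℝ → Matrix (Fin n) (Fin n) ℂ}
    (hA : EssBounded T A) (i j : Fin n) {v : ℝ → ℂ} (hv : Continuous v) {t : ℝ}
    (ht : t ∈ Icc 0 T) : IntervalIntegrable (fun s => A s i j * v s) volume 0 t := by
  rw [intervalIntegrable_iff_integrableOn_Ioc_of_le ht.1]
  have h1 : IntegrableOn (fun s => A s i j) (Ioc 0 t) := by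
    have h2 : IntegrableOn (fun s => A s i j) (Ioc 0 T) := (hA i j).integrable le_top
    exact h2.mono_set (Ioc_subset_Ioc_right ht.2)
  obtain ⟨C, hC⟩ := (isCompact_Icc (a := (0 : ℝ)) (b := T)).exists_bound_of_continuousOn
    hv.continuousOn
  refine Integrable.mul_bdd (c := C) h1 hv.aestronglyMeasurable ?_
  refine (ae_restrict_iff' measurableSet_Ioc).2 (ae_of_all _ fun s hs => ?_)
  exact hC s ⟨hs.1.le, hs.2.trans ht.2⟩

/-- The linear integral equation with bounded coefficients only has the trivial solution. -/
theorem eq_zero_of_integral_eq {A : ℝ → Matrix (Fin n) (Fin n) ℂ} (hA : EssBounded T A)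
    {u : ℝ → Fin n → ℂ} (hu : Continuous u)
    (h : ∀ t ∈ Icc 0 T, ∀ i, u t i = ∫ s in (0 : ℝ)..t, ∑ j, A s i j * u s j) :
    ∀ t ∈ Icc 0 T, u t = 0 := by
  obtain ⟨C, hC0, hC⟩ := hA.exists_ae_norm_le
  have hC' := (ae_restrict_iff' measurableSet_Ioc).1 hC
  have hint : ∀ a b, IntervalIntegrable (fun s => ‖u s‖) volume a b := fun a b =>
    hu.norm.intervalIntegrable a b
  have hle : ∀ t ∈ Icc 0 T, ‖u t‖ ≤ (n * C) * ∫ s in (0 : ℝ)..t, ‖u s‖ := by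
    intro t ht
    have hI : 0 ≤ ∫ s in (0 : ℝ)..t, ‖u s‖ :=
      intervalIntegral.integral_nonneg ht.1 fun s _ => norm_nonneg _
    refine (pi_norm_le_iff_of_nonneg (by positivity)).2 fun i => ?_
    rw [h t ht i, ← intervalIntegral.integral_const_mul]
    refine intervalIntegral.norm_integral_le_of_norm_le ht.1 ?_ ((hint 0 t).const_mul _)
    filter_upwards [hC'] with s hs hst
    refine (norm_sum_le _ _).trans ?_
    calc ∑ j, ‖A s i j * u s j‖ ≤ ∑ _j : Fin n, C * ‖u s‖ := by
          refine Finset.sum_le_sum fun j _ => ?_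
          rw [norm_mul]
          exact mul_le_mul (hs ⟨hst.1, hst.2.trans ht.2⟩ i j) (norm_le_pi_norm _ _)
            (norm_nonneg _) hC0
      _ = (n * C) * ‖u s‖ := by simp [mul_assoc]
  -- Grönwall is applied to the primitive of `‖u‖`, which is differentiable because `u` is
  -- continuous. The coefficients are only measurable, so `u` itself need not be differentiable
  -- everywhere.
  have hder : ∀ t, HasDerivAt (fun t => ∫ s in (0 : ℝ)..t, ‖u s‖) ‖u t‖ t := fun t =>
    intervalIntegral.integral_hasDerivAt_right (hint 0 t)
      (hu.norm.stronglyMeasurableAtFilter _ _) hu.norm.continuousAt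
  have hF := eq_zero_of_abs_deriv_le_mul_abs_self_of_eq_zero_right
    (f := fun t => ∫ s in (0 : ℝ)..t, ‖u s‖) (f' := fun t => ‖u t‖) (K := n * C) (a := 0) (b := T)
    (fun t _ => (hder t).continuousAt.continuousWithinAt) (fun t _ => (hder t).hasDerivWithinAt)
    (by simp) fun t ht => by
      have hI : 0 ≤ ∫ s in (0 : ℝ)..t, ‖u s‖ :=
        intervalIntegral.integral_nonneg ht.1 fun s _ => norm_nonneg _
      rw [norm_norm, Real.norm_of_nonneg hI]
      exact hle t ⟨ht.1, ht.2.le⟩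
  intro t ht
  have h1 := hle t ht
  rw [hF t ht, mul_zero] at h1
  exact norm_le_zero_iff.1 h1

end Uniqueness

/-! ### At most `n` characteristic multipliers. -/

section Multipliers

variable {n : ℕ} {T : ℝ}

/-- Vectors on which a diagonal map with distinct entries preserves the linear relations are
linearly independent. -/
theorem linearIndependent_of_relations {m : ℕ} {E : Type*} [AddCommGroup E] [Module ℂ E]
    {ξ : Fin m → E} (hξ : ∀ r, ξ r ≠ 0) {ρ : Fin m → ℂ} (hρ : Function.Injective ρ)
    (h : ∀ c : Fin m → ℂ, ∑ r, c r • ξ r = 0 → ∑ r, (c r * ρ r) • ξ r = 0) :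
    LinearIndependent ℂ ξ := by
  rw [Fintype.linearIndependent_iff]
  intro c hc r
  -- The relations are stable under every polynomial in `ρ`; a Lagrange basis polynomial then
  -- isolates one coefficient.
  have hpow : ∀ k : ℕ, ∑ r, (c r * ρ r ^ k) • ξ r = 0 := by
    intro k
    induction k with
    | zero => simpa using hc
    | succ k ih => simpa only [pow_succ, mul_assoc] using h _ ih
  have hpoly : ∀ p : Polynomial ℂ, ∑ r, (c r * p.eval (ρ r)) • ξ r = 0 := by
    intro p
    induction p using Polynomial.induction_on' with
    | add p q hp hq =>
      simp only [Polynomial.eval_add, mul_add, add_smul, Finset.sum_add_distrib, hp, hq, add_zero]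
    | monomial k a =>
      have := congrArg (fun v => a • v) (hpow k)
      simp only [Finset.smul_sum, smul_smul, smul_zero] at this
      simp only [Polynomial.eval_monomial]
      rw [← this]
      exact Finset.sum_congr rfl fun r _ => by congr 1; ring
  have h1 := hpoly (Lagrange.basis Finset.univ ρ r)
  rw [Finset.sum_eq_single r] at h1
  · rw [Lagrange.eval_basis_self hρ.injOn (Finset.mem_univ r), mul_one] at h1
    exact (smul_eq_zero.1 h1).resolve_right (hξ r)
  · intro s _ hs
    rw [Lagrange.eval_basis_of_ne hs.symm (Finset.mem_univ s), mul_zero, zero_smul]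
  · intro h
    exact absurd (Finset.mem_univ r) h

/-- There are at most `n` characteristic multipliers. -/
theorem card_multipliers_le [hT : Fact (0 < T)] {A : ℝ → Matrix (Fin n) (Fin n) ℂ}
    (hA : EssBounded T A) {m : ℕ} {μ : Fin m → ℂ}
    (hμ : ∀ r, IsEig (toeplitzOp A hA) (freq n T) (μ r))
    (hinj : Function.Injective fun r => Complex.exp (μ r * T)) : m ≤ n := by
  choose V hV0 hV using hμ
  let u : Fin m → ℝ → Fin n → ℂ := fun r t i =>
    Complex.exp (μ r * t) * signal T (V r) i (t : AddCircle T)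
  have hcont : ∀ r, Continuous (u r) := fun r => by
    refine continuous_pi fun i => ?_
    have h1 : Continuous fun t : ℝ => signal T (V r) i (t : AddCircle T) :=
      (signal T (V r) i).continuous.comp (AddCircle.continuous_mk' T)
    exact Continuous.mul (by fun_prop) h1
  have hTT : T ∈ Icc 0 T := ⟨hT.out.le, le_rfl⟩
  have hu0 : ∀ r i, u r 0 i = signal T (V r) i ((0 : ℝ) : AddCircle T) := fun r i => by simp [u]
  have huT : ∀ r, u r T = Complex.exp (μ r * T) • u r 0 := fun r => by
    funext i
    rw [Pi.smul_apply, hu0, smul_eq_mul]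
    simp only [u, AddCircle.coe_period, AddCircle.coe_zero]
  -- By uniqueness a relation between initial values persists in time. At `t = T` each term has been
  -- multiplied by its multiplier, as `linearIndependent_of_relations` requires.
  have hrel : ∀ c : Fin m → ℂ, ∑ r, c r • u r 0 = 0 → ∀ t ∈ Icc 0 T, ∑ r, c r • u r t = 0 := by
    intro c hc
    refine eq_zero_of_integral_eq hA
      (continuous_finsetSum _ fun r _ => (hcont r).const_smul (c r)) fun t ht i => ?_
    have h1 : ∀ r, u r t i - u r 0 i = ∫ s in (0 : ℝ)..t, ∑ j, A s i j * u r s j := fun r => by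
      rw [hu0]
      exact (hV r).signal_integral hA i ht
    have h2 : (∑ r, c r • u r t) i = ∑ r, c r * (u r t i - u r 0 i) := by
      have h3 := congrFun hc i
      simp only [Finset.sum_apply, Pi.smul_apply, smul_eq_mul, Pi.zero_apply] at h3 ⊢
      simp only [mul_sub, Finset.sum_sub_distrib, h3, sub_zero]
    have hI : ∀ r, IntervalIntegrable (fun s => ∑ j, A s i j * u r s j) volume 0 t := fun r => by
      have := IntervalIntegrable.sum Finset.univ (f := fun j s => A s i j * u r s j)
        fun j _ => hA.intervalIntegrable_mul i j ((continuous_apply j).comp (hcont r)) ht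
      simpa only [Finset.sum_fn] using this
    simp only [h2, h1, ← intervalIntegral.integral_const_mul]
    rw [← intervalIntegral.integral_finsetSum fun r _ => (hI r).const_mul (c r)]
    congr 1
    funext s
    simp only [Finset.sum_apply, Pi.smul_apply, smul_eq_mul, Finset.mul_sum]
    rw [Finset.sum_comm]
    exact Finset.sum_congr rfl fun j _ => Finset.sum_congr rfl fun r _ => by ring
  have hne : ∀ r, u r 0 ≠ 0 := by
    intro r hr
    have h1 : ∀ t ∈ Icc 0 T, u r t = 0 := by
      have := hrel (Pi.single r 1) (by
        rw [Finset.sum_eq_single r] <;> simp +contextual [hr])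
      intro t ht
      have h2 := this t ht
      rwa [Finset.sum_eq_single r (by simp +contextual) (by simp), Pi.single_eq_same,
        one_smul] at h2
    refine hV0 r ?_
    have h2 : ∀ i, signal T (V r) i = 0 := by
      intro i
      ext x
      obtain ⟨t, ht, rfl⟩ : x ∈ ((↑) : ℝ → AddCircle T) '' Icc 0 (0 + T) :=
        (AddCircle.coe_image_Icc_eq T 0).symm ▸ mem_univ x
      rw [zero_add] at ht
      have := congrFun (h1 t ht) i
      simpa [u] using this
    ext ⟨i, k⟩
    have h3 := coeFn_repr_symm_block (T := T) ((hV r).summable_block hT.out i)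
    rw [h2 i] at h3
    have h4 : (fourierBasis.repr.symm (block i (V r)) : Lp ℂ 2 (@haarAddCircle T hT)) = 0 :=
      Lp.ext (h3.trans (Lp.coeFn_zero ℂ 2 _).symm)
    have h5 : block i (V r) = 0 := by simpa using h4
    exact congrArg (fun w : EllTwo ℤ => w k) h5
  have hli : LinearIndependent ℂ fun r => u r 0 :=
    linearIndependent_of_relations hne hinj fun c hc => by
      have := hrel c hc T hTT
      simpa only [huT, smul_smul] using this
  simpa using hli.fintype_card_le_finrank

end Multipliers

/-! ### Spectrum of the harmonic operator and shifts between truncations. -/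

section StateOperator

variable {n : ℕ} {T : ℝ}

theorem toeplitz_shift (A : ℝ → Matrix (Fin n) (Fin n) ℂ) {p q p' q' : Fin n × ℤ}
    (h1 : p.1 = p'.1) (h2 : q.1 = q'.1) (h : p.2 - q.2 = p'.2 - q'.2) :
    toeplitz T A p q = toeplitz T A p' q' := by
  simp only [toeplitz, Matrix.of_apply, h1, h2, h]

/-- The translation of the frequencies by `k`. -/
def shiftEquiv (n : ℕ) (k : ℤ) : Fin n × ℤ ≃ Fin n × ℤ :=
  (Equiv.refl _).prodCongr (Equiv.addRight k)

theorem toeplitz_shiftEquiv (A : ℝ → Matrix (Fin n) (Fin n) ℂ) (k : ℤ) (p q : Fin n × ℤ) :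
    toeplitz T A (shiftEquiv n k p) (shiftEquiv n k q) = toeplitz T A p q :=
  toeplitz_shift A rfl rfl (by simp [shiftEquiv])

theorem freq_shiftEquiv (k : ℤ) (p : Fin n × ℤ) :
    freq n T p = freq n T (shiftEquiv n k p) - Complex.I * (omega T : ℂ) * k := by
  simp only [freq, shiftEquiv, Equiv.prodCongr_apply, Prod.map_snd, Equiv.coe_addRight]
  push_cast
  ring

theorem lambdaOne_shift (lam : Fin n → ℂ) (j₀ m : ℕ) (w : ℂ) :
    w + Complex.I * (omega T : ℂ) ∈ lambdaOne T lam j₀ (m + 1) ↔ w ∈ lambdaOne T lam j₀ m := by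
  constructor
  · rintro ⟨p, k, hk, h⟩
    refine ⟨p, k - 1, by push_cast at hk; lia, ?_⟩
    rw [eq_sub_of_add_eq h]
    push_cast
    ring
  · rintro ⟨p, k, hk, rfl⟩
    refine ⟨p, k + 1, by push_cast; lia, ?_⟩
    push_cast
    ring

variable [hT : Fact (0 < T)] {A : ℝ → Matrix (Fin n) (Fin n) ℂ} (hA : EssBounded T A)

theorem IsEig.shift {hA : EssBounded T A} {z : ℂ} (h : IsEig (toeplitzOp A hA) (freq n T) z) (k : ℤ) :
    IsEig (toeplitzOp A hA) (freq n T) (z + Complex.I * (omega T : ℂ) * k) :=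
  h.reindex (toeplitzOp_represents A hA) (toeplitzOp_represents A hA) (shiftEquiv n k)
    (toeplitz_shiftEquiv A k) (freq_shiftEquiv k)

theorem mem_opSpectrum_stateOp_iff (z : ℂ) :
    z ∈ opSpectrum (stateOp T A) ↔ IsEig (toeplitzOp A hA) (freq n T) z :=
  mem_opSpectrum_matrixOp_iff (toeplitzOp_represents A hA) (freq_re n T)
    (tendsto_norm_freq n hT.out) z

theorem exists_isEig_toeplitzOp (hn : 0 < n) : ∃ z, IsEig (toeplitzOp A hA) (freq n T) z := by
  have : Nonempty (Fin n × ℤ) := ⟨(⟨0, hn⟩, 0)⟩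
  exact exists_isEig (freq_re n T) (tendsto_norm_freq n hT.out) (toeplitzOp A hA)
    (omega_pos hT.out) (fun k => pull (shiftEquiv n k) (shiftEquiv n k).injective)
    (fun k x => norm_pull_equiv _ x) fun k z x y h =>
      h.reindex (toeplitzOp_represents A hA) (toeplitzOp_represents A hA) (shiftEquiv n k)
        (toeplitz_shiftEquiv A k) (freq_shiftEquiv k)

include hA in
-- Eigenvalues are grouped by the multiplier `exp (z T)`: equal multipliers mean a difference `jωk`,
-- and one representative is chosen in each of the at most `n` groups.
theorem exists_exponents :
    ∃ lam : Fin n → ℂ, opSpectrum (stateOp T A) = exponentSet T lam := by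
  classical
  let E : Set ℂ := {z | IsEig (toeplitzOp A hA) (freq n T) z}
  let Q : Set ℂ := (fun z : ℂ => Complex.exp (z * T)) '' E
  have hcard : ∀ s : Finset ℂ, ↑s ⊆ Q → s.card ≤ n := by
    intro s hs
    choose z hz hzs using fun q : s => hs q.2
    refine card_multipliers_le hA (m := s.card) (μ := fun r => z (s.equivFin.symm r))
      (fun r => hz _) fun r r' hr => ?_
    simp only [hzs] at hr
    exact s.equivFin.symm.injective (Subtype.ext hr)
  have hfin : Q.Finite := by
    by_contra hinf
    obtain ⟨s, hs, hsn⟩ := Set.Infinite.exists_subset_card_eq hinf (n + 1)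
    have := hcard s hs
    lia
  have hsurj : ∃ lam : Fin n → ℂ, (∀ p, lam p ∈ E) ∧
      ∀ w ∈ E, ∃ p, Complex.exp (w * T) = Complex.exp (lam p * T) := by
    rcases Nat.eq_zero_or_pos n with rfl | hn
    · refine ⟨fun p => p.elim0, fun p => p.elim0, fun w hw => ?_⟩
      have h1 := hcard {Complex.exp (w * T)} (by simpa using ⟨w, hw, rfl⟩)
      simp at h1
    · obtain ⟨z₀, hz₀⟩ := exists_isEig_toeplitzOp hA hn
      have : Fintype Q := hfin.fintype
      have : Nonempty Q := ⟨⟨_, z₀, hz₀, rfl⟩⟩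
      have h1 : Fintype.card Q ≤ Fintype.card (Fin n) := by
        rw [Fintype.card_fin, ← Set.toFinset_card]
        exact hcard _ (by simp)
      obtain ⟨g⟩ := Function.Embedding.nonempty_of_card_le h1
      choose ζ hζ hζq using fun q : Q => q.2
      -- A left inverse of the embedding is surjective from `Fin n` onto the multipliers and repeats
      -- values if there are fewer than `n`. It needs a multiplier to exist, hence the appeal to
      -- `exists_isEig_toeplitzOp`.
      refine ⟨fun p => ζ (Function.invFun g p), fun p => hζ _, fun w hw => ?_⟩
      obtain ⟨p, hp⟩ := Function.invFun_surjective g.injective ⟨_, w, hw, rfl⟩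
      refine ⟨p, ?_⟩
      have := hζq (Function.invFun g p)
      rw [hp] at this
      simp only at this ⊢
      rw [hp, this]
  obtain ⟨lam, hlam, hcover⟩ := hsurj
  have hT0 : (T : ℂ) ≠ 0 := Complex.ofReal_ne_zero.2 hT.out.ne'
  refine ⟨lam, Set.ext fun w => ?_⟩
  rw [mem_opSpectrum_stateOp_iff hA]
  constructor
  · intro hw
    obtain ⟨p, hp⟩ := hcover w hw
    obtain ⟨k, hk⟩ := Complex.exp_eq_exp_iff_exists_int.1 hp
    refine ⟨p, k, mul_right_cancel₀ hT0 ?_⟩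
    rw [hk, omega]
    push_cast
    field_simp
  · rintro ⟨p, k, rfl⟩
    exact (hlam p).shift k

theorem leftTruncOp_eq (T : ℝ) (A : ℝ → Matrix (Fin n) (Fin n) ℂ) (m : ℕ) :
    leftTruncOp T A m = matrixOp ((toeplitz T A).submatrix LeftIndex.incl LeftIndex.incl -
      Matrix.diagonal (freq n T ∘ (LeftIndex.incl : LeftIndex n m → Fin n × ℤ))) := by
  rw [leftTruncOp, leftTruncMatrix, Matrix.submatrix_sub]
  simp only [Pi.sub_apply, frequency]
  rw [Matrix.submatrix_diagonal _ _ LeftIndex.incl_injective]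
  rfl

theorem mem_eigenvalues_leftTruncOp_iff (m : ℕ) (z : ℂ) :
    z ∈ eigenvalues (leftTruncOp T A m) ↔
      IsEig (compress (LeftIndex.incl_injective (m := m)) (toeplitzOp A hA))
        (freq n T ∘ LeftIndex.incl) z := by
  rw [leftTruncOp_eq]
  exact mem_eigenvalues_matrixOp_iff
    (compress_represents LeftIndex.incl_injective (toeplitzOp_represents A hA)) _ z

theorem mem_range_incl_iff {m : ℕ} (p : Fin n × ℤ) :
    p ∈ range (LeftIndex.incl : LeftIndex n m → Fin n × ℤ) ↔ -(m : ℤ) ≤ p.2 := by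
  constructor
  · rintro ⟨q, rfl⟩
    exact q.2.2
  · intro h
    exact ⟨(p.1, ⟨p.2, h⟩), rfl⟩

include hA in
-- Toeplitz entries depend only on the index difference, and moving the cut-off from `-m` to `-m'`
-- is a translation of half-lines. Only the diagonal changes, by a constant.
theorem eigenvalues_leftTruncOp_shift {m : ℕ} (m' : ℕ) {z : ℂ}
    (h : z ∈ eigenvalues (leftTruncOp T A m)) :
    z + Complex.I * (omega T : ℂ) * (((m' : ℤ) - (m : ℤ) : ℤ) : ℂ) ∈
      eigenvalues (leftTruncOp T A m') := by
  rw [mem_eigenvalues_leftTruncOp_iff hA] at h ⊢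
  let e : LeftIndex n m' ≃ LeftIndex n m :=
    (Equiv.refl _).prodCongr
      { toFun := fun k => ⟨k + (m' - m), by have := k.2; simp only [mem_Ici] at this ⊢; lia⟩
        invFun := fun k => ⟨k - (m' - m), by have := k.2; simp only [mem_Ici] at this ⊢; lia⟩
        left_inv := fun k => by ext; simp
        right_inv := fun k => by ext; simp }
  refine h.reindex (compress_represents LeftIndex.incl_injective (toeplitzOp_represents A hA))
    (compress_represents LeftIndex.incl_injective (toeplitzOp_represents A hA)) e
    (fun p q => ?_) fun p => ?_
  · exact toeplitz_shift A rfl rfl (by simp [e, LeftIndex.incl])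
  · simp only [Function.comp_apply, freq, LeftIndex.incl, e, Equiv.prodCongr_apply, Prod.map_snd,
      Equiv.coe_fn_mk]
    push_cast
    ring

include hA in
theorem lambdaTwo_succ (lam : Fin n → ℂ) (ε : ℝ) (j₀ m : ℕ) :
    lambdaTwo T A lam ε j₀ (m + 1) =
      (fun z : ℂ => z + Complex.I * (omega T : ℂ)) '' lambdaTwo T A lam ε j₀ m := by
  have key : ∀ z, z + Complex.I * (omega T : ℂ) ∈ lambdaTwo T A lam ε j₀ (m + 1) ↔
      z ∈ lambdaTwo T A lam ε j₀ m := by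
    intro z
    have h1 : z + Complex.I * (omega T : ℂ) ∈ eigenvalues (leftTruncOp T A (m + 1)) ↔
        z ∈ eigenvalues (leftTruncOp T A m) := by
      constructor <;> intro h
      · have := eigenvalues_leftTruncOp_shift hA m h
        convert! this using 1
        push_cast
        ring
      · have := eigenvalues_leftTruncOp_shift hA (m + 1) h
        convert! this using 1
        push_cast
        ring
    refine and_congr h1 ⟨fun h w hw => ?_, fun h w hw => ?_⟩
    · have := h _ ((lambdaOne_shift lam j₀ m w).2 hw)
      rwa [dist_add_right] at this
    · have := h (w - Complex.I * (omega T : ℂ))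
        ((lambdaOne_shift lam j₀ m _).1 (by rwa [sub_add_cancel]))
      rwa [← dist_add_right _ _ (Complex.I * (omega T : ℂ)), sub_add_cancel] at this
  ext z
  constructor
  · intro h
    exact ⟨z - Complex.I * (omega T : ℂ), (key _).1 (by rwa [sub_add_cancel]), sub_add_cancel _ _⟩
  · rintro ⟨w, hw, rfl⟩
    exact (key w).2 hw

end StateOperator

/-! ### Approximation of the spectrum by truncations, finiteness, residuals. -/

section Truncation

variable {n : ℕ} {T : ℝ}

theorem le_norm_freq_of_notMem (hT : 0 < T) {m : ℕ} {p : Fin n × ℤ}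
    (hp : p ∉ range (LeftIndex.incl : LeftIndex n m → Fin n × ℤ)) :
    omega T * m ≤ ‖freq n T p‖ := by
  rw [mem_range_incl_iff, not_le] at hp
  rw [norm_freq n hT]
  refine mul_le_mul_of_nonneg_left ?_ (omega_pos hT).le
  have h1 : (p.2 : ℝ) < -m := by exact_mod_cast hp
  rw [abs_of_neg (h1.trans_le (by simp))]
  linarith

theorem eventually_mem_range_incl (p : Fin n × ℤ) :
    ∀ᶠ m : ℕ in atTop, p ∈ range (LeftIndex.incl : LeftIndex n m → Fin n × ℤ) := by
  filter_upwards [eventually_ge_atTop p.2.natAbs] with m hm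
  rw [mem_range_incl_iff]
  lia

theorem exponentSet_countable (T : ℝ) (lam : Fin n → ℂ) : (exponentSet T lam).Countable := by
  have : exponentSet T lam ⊆
      range fun q : Fin n × ℤ => lam q.1 + Complex.I * (omega T : ℂ) * (q.2 : ℂ) := by
    rintro z ⟨p, k, rfl⟩
    exact ⟨(p, k), rfl⟩
  exact (countable_range _).mono this

theorem eigenvalues_subset_thickening (A : ℝ → Matrix (Fin n) (Fin n) ℂ)
    (lam : Fin n → ℂ) (j₀ m : ℕ) {ε : ℝ} (hε : 0 < ε) :
    eigenvalues (leftTruncOp T A m) ⊆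
      Metric.thickening ε (lambdaOne T lam j₀ m ∪ lambdaTwo T A lam ε j₀ m) := by
  intro z hz
  rw [Metric.mem_thickening_iff]
  by_cases h : ∀ w ∈ lambdaOne T lam j₀ m, ε ≤ dist z w
  · exact ⟨z, Or.inr ⟨hz, h⟩, by rwa [dist_self]⟩
  · push Not at h
    obtain ⟨w, hw, hd⟩ := h
    exact ⟨w, Or.inl hw, hd⟩

variable [hT : Fact (0 < T)] {A : ℝ → Matrix (Fin n) (Fin n) ℂ} (hA : EssBounded T A)
  {lam : Fin n → ℂ} (hlam : ∀ z, IsEig (toeplitzOp A hA) (freq n T) z ↔ z ∈ exponentSet T lam)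
  {ε : ℝ} (hε : 0 < ε)

/-- The truncation of the Toeplitz operator, extended by zero. -/
noncomputable def truncOp (m : ℕ) : EllTwo (Fin n × ℤ) →L[ℂ] EllTwo (Fin n × ℤ) :=
  rangeProj (LeftIndex.incl_injective (m := m)) * toeplitzOp A hA *
    rangeProj (LeftIndex.incl_injective (m := m))

theorem norm_truncOp_le (m : ℕ) : ‖truncOp hA m‖ ≤ ‖toeplitzOp A hA‖ :=
  norm_rangeProj_mul_mul_le _ _

theorem tendsto_truncOp (x : EllTwo (Fin n × ℤ)) :
    Tendsto (fun m => truncOp hA m x) atTop (𝓝 (toeplitzOp A hA x)) :=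
  tendsto_rangeProj_mul_mul (f := fun m => (LeftIndex.incl : LeftIndex n m → Fin n × ℤ))
    (fun _ => LeftIndex.incl_injective) eventually_mem_range_incl _ x

theorem isEig_truncOp_of_mem_eigenvalues {m : ℕ} {z : ℂ}
    (h : z ∈ eigenvalues (leftTruncOp T A m)) : IsEig (truncOp hA m) (freq n T) z :=
  isEig_rangeProj_of_compress _ ((mem_eigenvalues_leftTruncOp_iff hA m z).1 h)

include hlam hε in
theorem eventually_exists_eigenvalue_near (p : Fin n) :
    ∀ᶠ m : ℕ in atTop, ∃ z ∈ eigenvalues (leftTruncOp T A m), dist z (lam p) < ε := by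
  have hω := omega_pos hT.out
  have hp : IsEig (toeplitzOp A hA) (freq n T) (lam p) := (hlam _).2 ⟨p, 0, by simp⟩
  -- The spectrum is countable, so some circle of radius below `ε` around `lam p` avoids it.
  obtain ⟨r, hr, hr'⟩ : ∃ r ∈ Ioo 0 ε, r ∉ (fun w => dist w (lam p)) '' exponentSet T lam := by
    by_contra! hcon
    exact (Cardinal.Real.Ioo_countable_iff.1
      (((exponentSet_countable T lam).image _).mono hcon)).not_gt hε
  have h1 := eventually_exists_isEig_closedBall (freq_re n T) (tendsto_norm_freq n hT.out)
    (norm_truncOp_le hA) (tendsto_truncOp hA) hp hr.1 fun z hz hzE =>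
      hr' ⟨z, (hlam z).1 hzE, hz⟩
  -- For such `m` the extra eigenvalues `-d i` produced by extension by zero lie outside the disc.
  have h2 : ∀ᶠ m : ℕ in atTop, ‖lam p‖ + r < omega T * m :=
    (tendsto_natCast_atTop_atTop.const_mul_atTop hω).eventually_gt_atTop _
  filter_upwards [h1, h2] with m ⟨z, hz, hzE⟩ hm
  refine ⟨z, (mem_eigenvalues_leftTruncOp_iff hA m z).2
    (isEig_compress_of_rangeProj _ hzE fun q hq h0 => ?_), lt_of_le_of_lt hz hr.2⟩
  have h3 := le_norm_freq_of_notMem hT.out hq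
  rw [eq_neg_of_add_eq_zero_left h0, norm_neg] at h3
  have h4 : ‖z‖ ≤ ‖lam p‖ + r := by
    have := norm_le_norm_add_norm_sub' z (lam p)
    rw [← dist_eq_norm] at this
    exact this.trans (by gcongr; exact hz)
  linarith

include hA in
theorem lambdaOne_subset_thickening {j₀ : ℕ} (hj₀ : 1 ≤ j₀)
    (hj : ∀ p, ∀ m : ℕ, j₀ ≤ m + 1 → ∃ z ∈ eigenvalues (leftTruncOp T A m), dist z (lam p) < ε)
    (m : ℕ) : lambdaOne T lam j₀ m ⊆ Metric.thickening ε (eigenvalues (leftTruncOp T A m)) := by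
  rintro _ ⟨p, k, hk, rfl⟩
  rw [Metric.mem_thickening_iff]
  -- The level `m - k` is at least `j₀ - 1 ≥ 0`, and passing from it to level `m` adds exactly
  -- `jωk`.
  obtain ⟨z, hz, hzp⟩ := hj p (m - k).toNat (by lia)
  refine ⟨_, eigenvalues_leftTruncOp_shift hA m hz, ?_⟩
  have : (m : ℤ) - ((m - k).toNat : ℤ) = k := by lia
  rw [this, dist_add_right, dist_comm]
  exact hzp

include hlam hε in
theorem lambdaTwo_finite (j₀ m : ℕ) : (lambdaTwo T A lam ε j₀ m).Finite := by
  have hω := omega_pos hT.out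
  set b := ‖toeplitzOp A hA‖ + 1
  obtain ⟨L, hL⟩ : ∃ L : ℝ, ∀ p, ‖lam p‖ ≤ L :=
    ⟨∑ p, ‖lam p‖, fun p => Finset.single_le_sum (fun q _ => norm_nonneg (lam q)) (Finset.mem_univ p)⟩
  have hS : IsCompact (Icc (-b) b ×ℂ Icc 0 (omega T)) := isCompact_Icc.reProdIm isCompact_Icc
  obtain ⟨N, hN⟩ := eventually_atTop.1 (eventually_exists_isEig_near (freq_re n T)
    (tendsto_norm_freq n hT.out) (norm_truncOp_le hA) (tendsto_truncOp hA) hS hε)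
  have hre : ∀ {m : ℕ} {z : ℂ}, z ∈ eigenvalues (leftTruncOp T A m) → |z.re| < b := fun h =>
    ((isEig_truncOp_of_mem_eigenvalues hA h).abs_re_lt (freq_re n T)).trans_le
      (add_le_add_left (norm_truncOp_le hA _) 1)
  let K : ℤ := ⌈(omega T + ε + L) / omega T⌉
  let q₀ : ℤ := max N (K + j₀)
  -- A lower `z` is lifted by `jωq` into `0 ≤ Im ≤ ω` at level `m + q ≥ N`, where it is `ε`-close to
  -- some `lam p + jωk` with `k ≤ K`. Undoing the lift gives the index `k - q < -j₀`, so `z` would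
  -- be `ε`-close to `Λ₁⁺(m)`.
  have hlow : ∀ z ∈ lambdaTwo T A lam ε j₀ m, -(q₀ * omega T) ≤ z.im := by
    rintro z ⟨hz, hfar⟩
    by_contra! hlt
    set q : ℤ := -⌊z.im / omega T⌋
    have h1 := Int.floor_le (z.im / omega T)
    have h2 := Int.lt_floor_add_one (z.im / omega T)
    have hq : q₀ < q := by
      have h3 : z.im / omega T < ((-q₀ : ℤ) : ℝ) := by
        rw [div_lt_iff₀ hω]
        push_cast
        linarith
      have := Int.floor_lt.2 h3
      lia
    have hqN : (N : ℤ) < q := (le_max_left _ _).trans_lt hq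
    have hqK : K + j₀ < q := (le_max_right _ _).trans_lt hq
    have hz' := eigenvalues_leftTruncOp_shift hA (m + q).toNat hz
    have hcast : (((m + q).toNat : ℤ) - (m : ℤ)) = q := by lia
    rw [hcast] at hz'
    set z' : ℂ := z + Complex.I * (omega T : ℂ) * (q : ℂ) with hz'def
    have him : z'.im = z.im + omega T * q := by simp [z']
    have hmem : z' ∈ Icc (-b) b ×ℂ Icc 0 (omega T) := by
      rw [Complex.mem_reProdIm]
      refine ⟨abs_le.1 (hre hz').le, ?_⟩
      rw [le_div_iff₀ hω] at h1
      rw [div_lt_iff₀ hω] at h2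
      rw [him]
      simp only [q, Int.cast_neg]
      constructor <;> nlinarith
    obtain ⟨w, hw, hd⟩ := hN (m + q).toNat (by lia) z' hmem
      (isEig_truncOp_of_mem_eigenvalues hA hz')
    obtain ⟨p, k, rfl⟩ := (hlam w).1 hw
    have hkK : k ≤ K := by
      have h3 := (Complex.abs_im_le_norm _).trans_lt ((dist_eq_norm _ _).symm.trans_lt hd)
      have h4 := (Complex.abs_im_le_norm (lam p)).trans (hL p)
      have h5 := (Complex.mem_reProdIm.1 hmem).2.2
      simp only [Complex.sub_im, Complex.add_im, Complex.mul_im, Complex.mul_re, Complex.I_re,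
        Complex.I_im, Complex.ofReal_re, Complex.ofReal_im, Complex.intCast_re,
        Complex.intCast_im] at h3
      have h6 : (k : ℝ) ≤ (omega T + ε + L) / omega T := by
        rw [le_div_iff₀ hω]
        have := (abs_lt.1 h3).1
        have := (abs_le.1 h4).1
        nlinarith
      exact_mod_cast h6.trans (Int.le_ceil _)
    have h7 := hfar (lam p + Complex.I * (omega T : ℂ) * ((k - q : ℤ) : ℂ))
      ⟨p, k - q, by lia, rfl⟩
    rw [← dist_add_right _ _ (Complex.I * (omega T : ℂ) * (q : ℂ)), ← hz'def] at h7
    have h8 : lam p + Complex.I * (omega T : ℂ) * ((k - q : ℤ) : ℂ) +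
        Complex.I * (omega T : ℂ) * (q : ℂ) = lam p + Complex.I * (omega T : ℂ) * (k : ℂ) := by
      push_cast
      ring
    rw [h8] at h7
    linarith
  -- Eigenvalues lie near the points `-jωk` with `k ≥ -m`, whose imaginary parts are at most `ωm`.
  obtain ⟨c, hc⟩ : ∃ c : ℝ, ∀ z ∈ lambdaTwo T A lam ε j₀ m, z.im ≤ c := by
    refine ⟨‖compress (LeftIndex.incl_injective (m := m)) (toeplitzOp A hA)‖ + 1 + omega T * m,
      fun z hz => ?_⟩
    obtain ⟨p, hp⟩ := ((mem_eigenvalues_leftTruncOp_iff hA m z).1 hz.1).exists_norm_lt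
    have h1 := (le_abs_self _).trans ((Complex.abs_im_le_norm _).trans hp.le)
    have h2 : (-(m : ℤ) : ℝ) ≤ ((p.2 : ℤ) : ℝ) := by exact_mod_cast p.2.2
    simp [freq, LeftIndex.incl] at h1 h2
    nlinarith
  refine (finite_isEig_inter (freq_re n T) (tendsto_norm_freq n hT.out) (truncOp hA m)
    (S := Icc (-b) b ×ℂ Icc (-(q₀ * omega T)) c)
    (isCompact_Icc.reProdIm isCompact_Icc).isBounded).subset fun z hz => ?_
  exact ⟨isEig_truncOp_of_mem_eigenvalues hA hz.1,
    Complex.mem_reProdIm.2 ⟨abs_le.1 (hre hz.1).le, hlow z hz, hc z hz⟩⟩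

/-- The residual of a truncated eigenvector is small if the frequencies deleted by the truncation
are far from those of the eigenvector. -/
theorem residual_lt {m : ℕ} {z : ℂ} {ρ : ℝ} (hρ : 0 < ρ)
    (hρ1 : 2 * ‖toeplitzOp A hA‖ ≤ ρ) (hρ2 : 4 * ‖toeplitzOp A hA‖ ^ 2 ≤ ε * ρ) (hε : 0 < ε)
    (hi : ∀ p, p ∉ range (LeftIndex.incl : LeftIndex n m → Fin n × ℤ) → ρ ≤ ‖freq n T p + z‖)
    {V : EllTwo (Fin n × ℤ)} (hV : IsEigenvector (stateOp T A) z V) (hV1 : ‖V‖ = 1) :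
    ∃ h : leftTruncVec m V ∈ (leftTruncOp T A m).domain,
      ‖leftTruncOp T A m ⟨leftTruncVec m V, h⟩ - z • leftTruncVec m V‖ < ε ∧
      ‖leftTruncOp T A m ⟨leftTruncVec m V, h⟩ - z • leftTruncVec m V‖ <
        ε * ‖leftTruncVec m V‖ := by
  set b := ‖toeplitzOp A hA‖
  have hb : 0 ≤ b := norm_nonneg _
  have hs : Sol (toeplitzOp A hA) (freq n T) z V 0 :=
    ((isEigenvector_matrixOp_iff (toeplitzOp_represents A hA) (freq n T) z V).1 hV).2
  have hinj := LeftIndex.incl_injective (n := n) (m := m)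
  have hc := hs.compress hinj
  have hrep := compress_represents hinj (toeplitzOp_represents A hA)
  have hdom := (matrixOp_sub_smul_iff hrep _ z _ _).2 hc
  rw [← leftTruncOp_eq] at hdom
  obtain ⟨h, hres⟩ := hdom
  refine ⟨h, ?_⟩
  change ‖leftTruncOp T A m ⟨pull LeftIndex.incl hinj V, h⟩ - z • pull LeftIndex.incl hinj V‖ < ε ∧
    ‖leftTruncOp T A m ⟨pull LeftIndex.incl hinj V, h⟩ - z • pull LeftIndex.incl hinj V‖ <
      ε * ‖pull LeftIndex.incl hinj V‖
  rw [hres]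
  -- The tail satisfies `ρτ ≤ b`. The two conditions on `ρ` give `bτ ≤ ε/4` and `τ ≤ 1/2`, so the
  -- residual is at most `ε/4` while the truncated vector keeps norm at least `1/2`.
  have htail := hs.norm_tail_le hinj hρ hi
  rw [hV1, mul_one] at htail
  set τ := ‖rangeProj hinj V - V‖
  have hτ0 : 0 ≤ τ := norm_nonneg _
  have h1 : ‖pull LeftIndex.incl hinj (toeplitzOp A hA (rangeProj hinj V - V))‖ ≤ b * τ :=
    (norm_pull_le hinj _).trans ((toeplitzOp A hA).le_opNorm _)
  have h2 : b * τ ≤ ε / 4 := by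
    have : ρ * (b * τ) ≤ ρ * (ε / 4) := by nlinarith
    exact le_of_mul_le_mul_left this hρ
  have h3 : τ ≤ 1 / 2 := by
    have : ρ * τ ≤ ρ * (1 / 2) := by linarith
    exact le_of_mul_le_mul_left this hρ
  have h4 : 1 / 2 ≤ ‖pull LeftIndex.incl hinj V‖ := by
    have h5 := norm_rangeProj_apply_le_pull hinj V
    have h6 : ‖V‖ ≤ ‖rangeProj hinj V‖ + τ := by
      have := norm_sub_norm_le V (rangeProj hinj V)
      rw [norm_sub_rev] at this
      linarith
    linarith
  constructor <;> nlinarith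

end Truncation

end HarmonicState

/-! ### Choice of `j₀` and assembly. -/

theorem mainTheorem5 (n : ℕ) (T : ℝ) (hT : 0 < T) (A : ℝ → Matrix (Fin n) (Fin n) ℂ)
    (hper : Function.Periodic A T) (hA : HarmonicState.EssBounded T A) :
    (∃ lam : Fin n → ℂ, HarmonicState.opSpectrum (HarmonicState.stateOp T A) =
        HarmonicState.exponentSet T lam) ∧
    ∀ lam : Fin n → ℂ,
      HarmonicState.opSpectrum (HarmonicState.stateOp T A) = HarmonicState.exponentSet T lam →
      ∀ ε : ℝ, 0 < ε → ∃ j₀ : ℕ,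
        -- the true eigenvalues in `Λ₁⁺(m)` are `ε`-approximate eigenvalues of the truncation
        (∀ m : ℕ, ∀ z ∈ HarmonicState.lambdaOne T lam j₀ m,
          z ∈ HarmonicState.eigenvalues (HarmonicState.stateOp T A) ∧
          ∀ V : HarmonicState.EllTwo (Fin n × ℤ),
            HarmonicState.IsEigenvector (HarmonicState.stateOp T A) z V → ‖V‖ = 1 →
            ∃ h : HarmonicState.leftTruncVec m V ∈ (HarmonicState.leftTruncOp T A m).domain,
              ‖HarmonicState.leftTruncOp T A m ⟨HarmonicState.leftTruncVec m V, h⟩ -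
                  z • HarmonicState.leftTruncVec m V‖ < ε ∧
              ‖HarmonicState.leftTruncOp T A m ⟨HarmonicState.leftTruncVec m V, h⟩ -
                  z • HarmonicState.leftTruncVec m V‖ < ε * ‖HarmonicState.leftTruncVec m V‖) ∧
        -- `Λ_{m⁺}` and `Λ₁⁺(m) ∪ Λ₂⁺(m)` agree up to `ε`
        (∀ m : ℕ,
          HarmonicState.eigenvalues (HarmonicState.leftTruncOp T A m) ⊆
            Metric.thickening ε (HarmonicState.lambdaOne T lam j₀ m ∪
              HarmonicState.lambdaTwo T A lam ε j₀ m) ∧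
          HarmonicState.lambdaOne T lam j₀ m ∪ HarmonicState.lambdaTwo T A lam ε j₀ m ⊆
            Metric.thickening ε (HarmonicState.eigenvalues (HarmonicState.leftTruncOp T A m))) ∧
        -- `Λ₂⁺(m)` is a finite set of eigenvalues of the truncation
        (∀ m : ℕ,
          HarmonicState.lambdaTwo T A lam ε j₀ m ⊆
            HarmonicState.eigenvalues (HarmonicState.leftTruncOp T A m) ∧
          (HarmonicState.lambdaTwo T A lam ε j₀ m).Finite) ∧
        -- `Λ₂⁺(m + 1)` is `Λ₂⁺(m)` shifted by `jω`
        (∀ m : ℕ, HarmonicState.lambdaTwo T A lam ε j₀ (m + 1) =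
          (fun z : ℂ => z + Complex.I * (HarmonicState.omega T : ℂ)) ''
            HarmonicState.lambdaTwo T A lam ε j₀ m) := by
  have : Fact (0 < T) := ⟨hT⟩
  open HarmonicState in
  refine ⟨exists_exponents hA, fun lam hσ ε hε => ?_⟩
  have hω := omega_pos hT
  have hlam : ∀ z, IsEig (toeplitzOp A hA) (freq n T) z ↔ z ∈ exponentSet T lam := fun z => by
    rw [← hσ, mem_opSpectrum_stateOp_iff hA]
  obtain ⟨N, hN⟩ := Filter.eventually_atTop.1 (Filter.eventually_all.2
    (eventually_exists_eigenvalue_near hA hlam hε))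
  set b := ‖toeplitzOp A hA‖
  have hb : 0 ≤ b := norm_nonneg _
  obtain ⟨L, hL⟩ : ∃ L : ℝ, ∀ p, ‖lam p‖ ≤ L :=
    ⟨∑ p, ‖lam p‖, fun p => Finset.single_le_sum (fun q _ => norm_nonneg (lam q)) (Finset.mem_univ p)⟩
  -- The first two terms meet the two conditions of `residual_lt`, and the last makes `ρ` positive.
  let ρ : ℝ := 2 * b + 4 * b ^ 2 / ε + 1
  have hρ : 0 < ρ := by positivity
  obtain ⟨N', hN'⟩ := exists_nat_ge ((ρ + L) / omega T)
  rw [div_le_iff₀ hω] at hN'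
  -- `N` serves the approximation of each `lam p` and `N'` the residual; the final `1` turns `j₀ ≤
  -- m' + 1` into `N ≤ m'`.
  let j₀ : ℕ := N + N' + 1
  refine ⟨j₀, fun m z hz => ?_, fun m => ⟨eigenvalues_subset_thickening A lam j₀ m hε,
    Set.union_subset (lambdaOne_subset_thickening hA (by lia)
      (fun p m' hm' => hN m' (by lia) p) m)
      fun z hz => Metric.self_subset_thickening hε _ hz.1⟩,
    fun m => ⟨fun z hz => hz.1, lambdaTwo_finite hA hlam hε j₀ m⟩, lambdaTwo_succ hA lam ε j₀⟩
  obtain ⟨p, k, hk, rfl⟩ := hz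
  constructor
  · exact (mem_eigenvalues_matrixOp_iff (toeplitzOp_represents A hA) (freq n T) _).2
      ((hlam _).2 ⟨p, k, rfl⟩)
  · intro V hV hV1
    refine residual_lt hA hρ ?_ ?_ hε (fun q hq => ?_) hV hV1
    · have : 0 ≤ 4 * b ^ 2 / ε := by positivity
      change 2 * b ≤ 2 * b + 4 * b ^ 2 / ε + 1
      linarith
    · have : ε * ρ = 2 * (ε * b) + 4 * b ^ 2 + ε := by
        simp only [ρ]
        field_simp
      rw [this]
      have : 0 ≤ ε * b := by positivity
      linarith
    · rw [mem_range_incl_iff, not_le] at hq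
      -- A deleted index is at most `-m - 1` and `k ≤ m + 1 - j₀`, so the sum is at most `-j₀`.
      -- Hence `|freq + z| ≥ ωN' - L ≥ ρ`.
      have h1 : (q.2 + k : ℤ) ≤ -(N' : ℤ) := by lia
      have h2 : (q.2 : ℝ) + k ≤ -N' := by exact_mod_cast h1
      have h3 := (le_abs_self _).trans ((Complex.abs_im_le_norm (lam p)).trans (hL p))
      have h4 := (neg_le_abs _).trans (Complex.abs_im_le_norm
        (freq n T q + (lam p + Complex.I * (omega T : ℂ) * (k : ℂ))))
      simp only [freq, Complex.add_im, Complex.mul_im, Complex.mul_re, Complex.I_re,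
        Complex.I_im, Complex.ofReal_re, Complex.ofReal_im, Complex.intCast_re,
        Complex.intCast_im] at h4
      refine le_trans ?_ h4
      nlinarith
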